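/- Let $M$ be a compact smooth Riemannian manifold without boundary, of dimension $d$, with Riemannian distance $\mathrm{dist}$ (infinite between different components). For $f:M\to M$, $S\subset M$, $\varepsilon>0$, $n\ge 0$, let $r_f(\varepsilon,n,S)$ be the minimal number of dynamical balls $B_f(\varepsilon,n,x)=\{y:\mathrm{dist}(f^jy,f^jx)<\varepsilon,\ 0\le j<n\}$ covering $S$; the topological entropy is $h_{\rm top}(f)=\lim_{\varepsilon\to0}\limsup_{n\to\infty}\frac1n\log r_f(\varepsilon,n,M)$. Fix a finite smooth atlas: smooth charts $\chi_i$ ($\mathbb R^d$-valued) and open sets $U_i$ covering $M$, with $\overline{U_i}$ contained in the domain of $\chi_i$. A $C^\infty$ singular $k$-disk is a map $\phi:Q^k=[-1,1]^k\to M$ that extends to a $C^\infty$ map on a neighbourhood of $Q^k$; its size is $$\|\phi\|_{C^\infty}=\sup_{t\in Q^k}\ \min_{i:\,\phi(t)\in U_i}\ \sup_{|s|\ge1}\ \max_{1\le j\le d}\bigl|\partial^s(\chi_i\circ\phi)_j(t)\bigr| .$$ The $k$-dimensional uniform entropy of $f$ is $$H^k_{\rm top}(f)=\lim_{\varepsilon\to0}\limsup_{n\to\infty}\frac1n\log\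 \sup_{\|\phi\|_{C^\infty}\le1} r_f(\varepsilon,n,\phi(Q^k)),$$ the supremum being over the $C^\infty$ singular $k$-disks of size at most $1$. If $d\ge1$, $f$ is called entropy-expanding if $H^{d-1}_{\rm top}(f)<h_{\rm top}(f)$. For $f$ of class $C^1$ and $k\ge1$ let $\|\Lambda^kTf\|$ be the maximum, over $1\le\ell\le k$, $x\in M$ and the $\ell$-dimensional subspaces $S\subset T_xM$, of the Jacobian $\sqrt{\det((T_xf|_S)^*(T_xf|_S))}$ of $T_xf|_S$; put $\|\Lambda^0Tf\|=1$. Let $\mathrm{Lip}(f)$ be the best Lipschitz constant of $f$ and $\mathrm{lip}(f)=\max(\log\mathrm{Lip}(f),0)$. Then, for every such atlas: (A) If $f$ is a $C^1$ diffeomorphism of $M$, then $H^k_{\rm top}(f)\le\log\|\Lambda^kTf\|$ for all $0\le k\le d$. If moreover $d\ge 1$: $\log\|\Lambda^{d-1}Tf\|<h_{\rm top}(f)$ implies that $f$ is entropy-expanding; and $(d-1)\,\mathrm{lip}(f)<h_{\rm top}(f)$ implies $\log\|\Lambda^{d-1}Tf\|<h_{\rm top}(f)$, hence also that $f$ is entropy-expanding.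 (B) If $f:M\to M$ is any $C^1$ map, the statements of (A) hold with $\|\Lambda^kTf\|$ replaced everywhere by $\max(1,\|\Lambda^kTf\|)$. -/

import Mathlib

open Set Filter Topology Bundle Manifold Dynamics ExpGrowth
open scoped ENNReal ContDiff Uniformity

noncomputable section

namespace DimEntropy

/-! ### Uniform entropy of a collection of subsets -/

/-- Uniform topological entropy of a collection `𝒟` of subsets of `X`:
the limit, as the scale goes to zero (that is, the supremum over all entourages `U`), of
`limsup (1/n) log (sup of r_f(U, n, D) over D ∈ 𝒟)`, where `r_f(U, n, D) = coverMincard f D U n`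
is the minimal number of dynamical `(U, n)`-balls needed to cover `D`. -/
def uniformEntropy {X : Type*} [UniformSpace X] (f : X → X) (𝒟 : Set (Set X)) : EReal :=
  ⨆ U ∈ 𝓤 X, expGrowthSup fun n : ℕ ↦ ⨆ D ∈ 𝒟, ((coverMincard f D U n : ℕ∞) : ℝ≥0∞)

/-! ### Singular disks and their sizes -/

section Disks

/-- The cube `Q^k = [-1, 1]^k`. -/
def cube (k : ℕ) : Set (Fin k → ℝ) := Icc (-1) 1

variable {d : ℕ} {M : Type*} [TopologicalSpace M] [ChartedSpace (EuclideanSpace ℝ (Fin d)) M]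

/-- A map `φ`, given on a neighbourhood of the cube `Q^k` (and arbitrary elsewhere), is a
`C^r` singular `k`-disk. Only its restriction to `Q^k` is used below. -/
def IsSingularDisk {k : ℕ} (r : ℕ∞) (φ : (Fin k → ℝ) → M) : Prop :=
  ∃ U : Set (Fin k → ℝ), IsOpen U ∧ cube k ⊆ U ∧
    ContMDiffOn 𝓘(ℝ, Fin k → ℝ) (𝓡 d) (r : WithTop ℕ∞) φ U

variable (d M) in
/-- A finite smooth atlas of `M`, made of smooth charts `chart i` restricted to open sets `dom i`
that cover `M`. Each restricted chart extends to the closure of its domain (without this,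
sizes defined by two atlases would not be comparable). -/
structure FiniteAtlas where
  /-- number of charts -/
  card : ℕ
  /-- the charts -/
  chart : Fin card → OpenPartialHomeomorph M (EuclideanSpace ℝ (Fin d))
  /-- the domains of the restricted charts -/
  dom : Fin card → Set M
  chart_mem : ∀ i, chart i ∈ IsManifold.maximalAtlas (𝓡 d) ∞ M
  isOpen_dom : ∀ i, IsOpen (dom i)
  closure_dom_subset : ∀ i, closure (dom i) ⊆ (chart i).source
  cover : ⋃ i, dom i = univ

/-- The mixed partial derivative `∂_{c 0} ⋯ ∂_{c (m-1)}` at `t` of the `j`-th coordinate of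
a map `g : ℝ^k → ℝ^d`. -/
def partialDeriv {k m : ℕ} (g : (Fin k → ℝ) → EuclideanSpace ℝ (Fin d)) (c : Fin m → Fin k)
    (j : Fin d) (t : Fin k → ℝ) : ℝ :=
  iteratedFDeriv ℝ m (fun u ↦ g u j) t fun a ↦ Pi.single (c a) (1 : ℝ)

/-- The `C^r` size of a singular disk with respect to a finite atlas: supremum over the points
`t` of the cube of the infimum, over the charts around `φ t`, of the largest absolute value of
the partial derivatives at `t` of orders `1 ≤ m ≤ r` of the coordinates of `φ` in that chart. -/
def size (𝒜 : FiniteAtlas d M) (r : ℕ∞) {k : ℕ} (φ : (Fin k → ℝ) → M) : ℝ≥0∞ :=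
  ⨆ t ∈ cube k, ⨅ (i : Fin 𝒜.card) (_ : φ t ∈ 𝒜.dom i),
    ⨆ (m : ℕ) (_ : 1 ≤ m ∧ (m : ℕ∞) ≤ r) (c : Fin m → Fin k) (j : Fin d),
      ENNReal.ofReal |partialDeriv (𝒜.chart i ∘ φ) c j t|

/-- The standard uniform family: the (images of) `C^r` singular `k`-disks with size at most `1`. -/
def uniformDisks (𝒜 : FiniteAtlas d M) (r : ℕ∞) (k : ℕ) : Set (Set M) :=
  {D | ∃ φ : (Fin k → ℝ) → M, IsSingularDisk (d := d) r φ ∧ size 𝒜 r φ ≤ 1 ∧ D = φ '' cube k}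

end Disks

/-! ### Dimensional entropies -/

section Entropy

variable {d : ℕ} {M : Type*} [UniformSpace M] [ChartedSpace (EuclideanSpace ℝ (Fin d)) M]

/-- The `C^r`, `k`-dimensional uniform entropy. -/
def uniformDimEntropyOf (𝒜 : FiniteAtlas d M) (r : ℕ∞) (k : ℕ) (f : M → M) : EReal :=
  uniformEntropy f (uniformDisks 𝒜 r k)

/-- The `k`-dimensional uniform entropy `H^k_top(f)`, i.e. the one for `r = ∞`. -/
def uniformDimEntropy (𝒜 : FiniteAtlas d M) (k : ℕ) (f : M → M) : EReal :=
  uniformDimEntropyOf 𝒜 ⊤ k f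

/-- The topological entropy (Bowen-Dinaburg) of `f`. -/
def topEntropy {X : Type*} [UniformSpace X] (f : X → X) : EReal := coverEntropy f univ

/-- `f` is entropy-expanding: `H^{d-1}_top(f) < h_top(f)`, where `d ≥ 1` is the dimension. -/
def IsEntropyExpanding (𝒜 : FiniteAtlas d M) (f : M → M) : Prop :=
  uniformDimEntropy 𝒜 (d - 1) f < topEntropy f

end Entropy

/-! ### Jacobians and Lipschitz constants -/

/-- The Jacobian `√det((A|S)* (A|S))` of the restriction to a subspace `S` of a linear map `A`
between Euclidean spaces. -/
def jacobianOn {V W : Type*} [NormedAddCommGroup V] [InnerProductSpace ℝ V]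
    [FiniteDimensional ℝ V] [NormedAddCommGroup W] [InnerProductSpace ℝ W]
    [FiniteDimensional ℝ W] (A : V →ₗ[ℝ] W) (S : Submodule ℝ V) : ℝ :=
  √(LinearMap.det ((A.domRestrict S).adjoint ∘ₗ A.domRestrict S))

section Riemannian

variable {d : ℕ} {M : Type*} [TopologicalSpace M] [ChartedSpace (EuclideanSpace ℝ (Fin d)) M]
  [IsManifold (𝓡 d) ∞ M] [RiemannianBundle (fun x : M ↦ TangentSpace (𝓡 d) x)]

instance finiteDimensional_tangentSpace (x : M) :
    FiniteDimensional ℝ (TangentSpace (𝓡 d) x) :=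
  inferInstanceAs (FiniteDimensional ℝ (EuclideanSpace ℝ (Fin d)))

variable (d) in
/-- `‖Λ^k Tf‖`: the maximum, over `1 ≤ ℓ ≤ k`, `x ∈ M` and the `ℓ`-dimensional subspaces `S` of
`T_x M`, of the Jacobian of the restriction of `T_x f` to `S`. For `k = 0` it is the maximum
over `ℓ = 0`, i.e. `‖Λ^0 Tf‖ = 1` (unless `M` is empty). -/
def normLambda (k : ℕ) (f : M → M) : ℝ≥0∞ :=
  ⨆ (ℓ : ℕ) (_ : min 1 k ≤ ℓ ∧ ℓ ≤ k) (x : M) (S : Submodule ℝ (TangentSpace (𝓡 d) x))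
    (_ : Module.finrank ℝ S = ℓ),
    ENNReal.ofReal
      (jacobianOn (mfderiv (𝓡 d) (𝓡 d) f x :
        TangentSpace (𝓡 d) x →ₗ[ℝ] TangentSpace (𝓡 d) (f x)) S)

end Riemannian

/-- The best Lipschitz constant of `f`. -/
def lipConst {X : Type*} [EMetricSpace X] (f : X → X) : ℝ≥0∞ :=
  sInf {K : ℝ≥0∞ | ∀ x y, edist (f x) (f y) ≤ K * edist x y}

/-- `lip(f) = max (log Lip(f)) 0`. -/
def lip {X : Type*} [EMetricSpace X] (f : X → X) : EReal :=
  max (ENNReal.log (lipConst f)) 0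

end DimEntropy

end

/-! The proof counts dynamical balls at a variable scale. A disk of size at most one enters only as
a uniformly Lipschitz image of the cube, covered by `O(ρ⁻ᵏ)` balls of radius `ρ`, so its derivatives
of order above one play no role.

Let `Λ ≥ 1` bound the Jacobians of `Tf` on subspaces of dimension at most `k`; those of `F = f^[N]`
are then at most `Λ ^ N`. More than `k` directions may expand, so covering the image of an `r`-ball
by `r`-balls is too expensive. Instead the radius is allowed to grow: near `x` it is multiplied by
`2 ^ q`, with `q = q x` such that at most `k` singular values of `T_x F` exceed `2 ^ q`
(`exists_dyadic_scale`). The image is then covered by `G Λ ^ N / 2 ^ (k q)` balls of radius `2 ^ q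
r`, where `G` depends only on `d` and `k` (`exists_local_ball_expansion`).

Fix the exponents met along an orbit of length `n`, with sum `s`. Starting from radius `r₀ / 2 ^ s`,
all later radii stay below `r₀`. The disk needs `O(2 ^ (k s))` initial balls, and the gains `2 ^ (-k
q)` cancel exactly this cost, which leaves `O((G Λ ^ N) ^ n)` cells
(`HasBallExpansion.exists_cells_cover`). Since `2 ^ q ≤ 2 Λ ^ N`, there are only `O(N)` possible
exponents, hence an entropy at most `(1/N) log (O(N) G Λ ^ N)`, which tends to `log Λ` as `N → ∞`.
This is the bound for maps (`uniformDimEntropy_le_log_max`).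

For a surjective map on a nonempty manifold the maximum with `1` is superfluous: if `k ≥ 1` and
`‖Λ^k Tf‖ < 1`, then `f` contracts small distances, and a compact space that is its own image under
such a map is finite (`one_le_normLambda_of_surjective`). The Lipschitz criterion holds because `T_x
f` has norm at most `Lip(f)`, so its `ℓ`-dimensional Jacobians are at most `Lip(f) ^ ℓ`. -/

set_option linter.unusedSectionVars false

noncomputable section

namespace DimEntropy

/-! ### Riemannian norms read in a chart -/

section Geometry

variable {d : ℕ} {M : Type*} [TopologicalSpace M] [ChartedSpace (EuclideanSpace ℝ (Fin d)) M]
  [IsManifold (𝓡 d) ∞ M] [RiemannianBundle (fun x : M ↦ TangentSpace (𝓡 d) x)]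

/-- The Riemannian norm at `x` of a tangent vector, read in the preferred chart at `x`. -/
def tangentNorm (x : M) (v : EuclideanSpace ℝ (Fin d)) : ℝ :=
  ‖(show TangentSpace (𝓡 d) x from v)‖

variable (d) in
/-- The identification of the model space with the tangent space at `x`, as a continuous linear
map. -/
def toTangent (x : M) : EuclideanSpace ℝ (Fin d) →L[ℝ] TangentSpace (𝓡 d) x :=
  show EuclideanSpace ℝ (Fin d) →L[ℝ] EuclideanSpace ℝ (Fin d) from
    ContinuousLinearMap.id ℝ (EuclideanSpace ℝ (Fin d))

lemma tangentNorm_eq_norm_toTangent (x : M) (v : EuclideanSpace ℝ (Fin d)) :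
    tangentNorm x v = ‖toTangent d x v‖ := rfl

variable [IsContinuousRiemannianBundle (EuclideanSpace ℝ (Fin d))
      (fun x : M ↦ TangentSpace (𝓡 d) x)]

/-- The derivative of the chart is the tangent bundle trivialization based at `x`, whose distortion
tends to `1` at `x` because the metric is continuous. -/
lemma eventually_tangentNorm_mfderiv_extChartAt_le (x : M) {C : ℝ} (hC : 1 < C) :
    ∀ᶠ y in 𝓝 x, ∀ v : TangentSpace (𝓡 d) y,
      tangentNorm x (mfderiv (𝓡 d) 𝓘(ℝ, EuclideanSpace ℝ (Fin d)) (extChartAt (𝓡 d) x) y v) ≤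
        C * ‖v‖ := by
  have hx : (chartAt (EuclideanSpace ℝ (Fin d)) x).source ∈ 𝓝 x := chart_source_mem_nhds _ x
  filter_upwards [eventually_norm_symmL_trivializationAt_self_comp_lt (EuclideanSpace ℝ (Fin d))
    (fun x : M ↦ TangentSpace (𝓡 d) x) x hC, hx] with y hy h'y v
  rw [← TangentBundle.continuousLinearMapAt_trivializationAt h'y]
  refine le_trans (le_of_eq ?_) ((ContinuousLinearMap.le_of_opNorm_le _ hy.le v))
  rw [TangentBundle.symmL_trivializationAt (mem_chart_source _ x), mfderivWithin_range_extChartAt_symm]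
  rfl

lemma eventually_norm_mfderivWithin_extChartAt_symm_le (x : M) {C : ℝ} (hC : 1 < C) :
    ∀ᶠ y in 𝓝 x, ∀ v : EuclideanSpace ℝ (Fin d),
      tangentNorm y (mfderivWithin 𝓘(ℝ, EuclideanSpace ℝ (Fin d)) (𝓡 d) (extChartAt (𝓡 d) x).symm
        (range (𝓡 d)) (extChartAt (𝓡 d) x y) v) ≤ C * tangentNorm x v := by
  have hx : (chartAt (EuclideanSpace ℝ (Fin d)) x).source ∈ 𝓝 x := chart_source_mem_nhds _ x
  filter_upwards [eventually_norm_symmL_trivializationAt_comp_self_lt (EuclideanSpace ℝ (Fin d))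
    (fun x : M ↦ TangentSpace (𝓡 d) x) x hC, hx] with y hy h'y v
  rw [← TangentBundle.symmL_trivializationAt h'y]
  refine le_trans (le_of_eq ?_) ((ContinuousLinearMap.le_of_opNorm_le _ hy.le v))
  rw [TangentBundle.continuousLinearMapAt_trivializationAt (mem_chart_source _ x), mfderiv_extChartAt_self]
  rfl

end Geometry

/-! ### Riemannian distance against the fixed norm at the base point -/

section RiemannianDistance

variable {d : ℕ} {M : Type*} [EMetricSpace M] [ChartedSpace (EuclideanSpace ℝ (Fin d)) M]
  [IsManifold (𝓡 d) ∞ M] [RiemannianBundle (fun x : M ↦ TangentSpace (𝓡 d) x)]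
  [IsContinuousRiemannianBundle (EuclideanSpace ℝ (Fin d))
      (fun x : M ↦ TangentSpace (𝓡 d) x)] [IsRiemannianManifold (𝓡 d) M]

/-- The segment joining the two points in the chart is an admissible path, and its Riemannian length
is at most `C` times its length for the norm at `x`. -/
lemma eventually_edist_le_tangentNorm (x : M) {C : ℝ} (hC : 1 < C) :
    ∀ᶠ p in 𝓝 x ×ˢ 𝓝 x, edist p.1 p.2 ≤
      ENNReal.ofReal (C * tangentNorm x (extChartAt (𝓡 d) x p.2 - extChartAt (𝓡 d) x p.1)) := by
  have hsymm := eventually_norm_mfderivWithin_extChartAt_symm_le (d := d) x hC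
  have h1 : ∀ᶠ z in 𝓝 (extChartAt (𝓡 d) x x), z ∈ (extChartAt (𝓡 d) x).target ∧
      ∀ v : EuclideanSpace ℝ (Fin d),
      tangentNorm ((extChartAt (𝓡 d) x).symm z) (mfderivWithin 𝓘(ℝ, EuclideanSpace ℝ (Fin d)) (𝓡 d)
        (extChartAt (𝓡 d) x).symm (range (𝓡 d)) z v) ≤ C * tangentNorm x v := by
    have h0 : ∀ᶠ z in 𝓝 (extChartAt (𝓡 d) x x), z ∈ (extChartAt (𝓡 d) x).target := by
      simpa using extChartAt_target_mem_nhdsWithin (I := 𝓡 d) x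
    have hc : Tendsto (extChartAt (𝓡 d) x).symm (𝓝 (extChartAt (𝓡 d) x x)) (𝓝 x) := by
      simpa [ContinuousAt] using continuousAt_extChartAt_symm (I := 𝓡 d) x
    filter_upwards [h0, hc.eventually hsymm] with z hz h
    refine ⟨hz, fun v ↦ ?_⟩
    have := h v
    rwa [(extChartAt (𝓡 d) x).right_inv hz] at this
  obtain ⟨r, r_pos, hr⟩ := Metric.mem_nhds_iff.1 h1
  have A : ∀ᶠ y in 𝓝 x, y ∈ (extChartAt (𝓡 d) x).source ∧
      extChartAt (𝓡 d) x y ∈ Metric.ball (extChartAt (𝓡 d) x x) r :=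
    Filter.Eventually.and (extChartAt_source_mem_nhds (I := 𝓡 d) x)
      ((continuousAt_extChartAt (I := 𝓡 d) x).preimage_mem_nhds (Metric.ball_mem_nhds _ r_pos))
  filter_upwards [A.prod_mk A] with ⟨p, q⟩ ⟨⟨hp, hp'⟩, ⟨hq, hq'⟩⟩
  dsimp only at hp hp' hq hq' ⊢
  set e := extChartAt (𝓡 d) x with he
  let η : ℝ → EuclideanSpace ℝ (Fin d) := fun t ↦ e p + t • (e q - e p)
  have hη : ∀ t ∈ Icc (0 : ℝ) 1, η t ∈ Metric.ball (e x) r := fun t ht ↦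
    (convex_ball (e x) r).add_smul_sub_mem hp' hq' ht
  have hη_deriv : ∀ t, HasFDerivAt η ((ContinuousLinearMap.id ℝ ℝ).smulRight (e q - e p)) t := by
    intro t
    exact ((hasFDerivAt_id t).smul_const (e q - e p)).const_add (e p)
  have η_smooth : ContMDiffOn 𝓘(ℝ, ℝ) 𝓘(ℝ, EuclideanSpace ℝ (Fin d)) 1 η (Icc 0 1) := by
    apply ContMDiff.contMDiffOn
    rw [contMDiff_iff_contDiff]
    fun_prop
  have key : riemannianEDist (𝓡 d) p q ≤ pathELength (𝓡 d) (e.symm ∘ η) 0 1 := by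
    apply riemannianEDist_le_pathELength _ _ _ zero_le_one
    · exact (contMDiffOn_extChartAt_symm x).comp η_smooth (fun t ht ↦ (hr (hη t ht)).1)
    · simp [η, e.left_inv hp]
    · simp [η, e.left_inv hq]
  rw [IsRiemannianManifold.out (I := 𝓡 d) p q]
  refine key.trans ?_
  rw [pathELength_eq_lintegral_mfderivWithin_Icc]
  calc _ ≤ ∫⁻ t in Icc (0 : ℝ) 1, ENNReal.ofReal (C * tangentNorm x (e q - e p)) := by
        apply MeasureTheory.setLIntegral_mono' measurableSet_Icc (fun t ht ↦ ?_)
        have hcomp : mfderivWithin 𝓘(ℝ, ℝ) (𝓡 d) (e.symm ∘ η) (Icc 0 1) t =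
            (mfderivWithin 𝓘(ℝ, EuclideanSpace ℝ (Fin d)) (𝓡 d) e.symm (range (𝓡 d)) (η t)) ∘L
              (mfderivWithin 𝓘(ℝ, ℝ) 𝓘(ℝ, EuclideanSpace ℝ (Fin d)) η (Icc 0 1) t) := by
          apply mfderivWithin_comp
          · exact mdifferentiableWithinAt_extChartAt_symm (hr (hη t ht)).1
          · exact η_smooth.mdifferentiableOn one_ne_zero t ht
          · exact fun t ht ↦ extChartAt_target_subset_range x (hr (hη t ht)).1
          · rw [uniqueMDiffWithinAt_iff_uniqueDiffWithinAt]
            exact uniqueDiffOn_Icc zero_lt_one t ht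
        have hη' : mfderivWithin 𝓘(ℝ, ℝ) 𝓘(ℝ, EuclideanSpace ℝ (Fin d)) η (Icc 0 1) t =
            (ContinuousLinearMap.id ℝ ℝ).smulRight (e q - e p) := by
          rw [mfderivWithin_eq_fderivWithin]
          exact (hη_deriv t).hasFDerivWithinAt.fderivWithin (uniqueDiffOn_Icc zero_lt_one t ht)
        rw [← ofReal_norm]
        apply ENNReal.ofReal_le_ofReal
        rw [hcomp, hη']
        refine le_trans (le_of_eq ?_) ((hr (hη t ht)).2 (e q - e p))
        have : ((ContinuousLinearMap.id ℝ ℝ).smulRight (e q - e p)) 1 = e q - e p := by simp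
        exact congrArg (fun w ↦ tangentNorm (e.symm (η t)) (mfderivWithin
          𝓘(ℝ, EuclideanSpace ℝ (Fin d)) (𝓡 d) e.symm (range (𝓡 d)) (η t) w)) this
    _ = _ := by simp

/-- A nearly shortest path cannot leave the neighbourhood where the chart has distortion at most
`C`; its image in the chart is at least as long as the straight displacement. -/
lemma eventually_tangentNorm_le_edist (x : M) {C : ℝ} (hC : 1 < C) :
    ∀ᶠ p in 𝓝 x ×ˢ 𝓝 x,
      ENNReal.ofReal (tangentNorm x (extChartAt (𝓡 d) x p.2 - extChartAt (𝓡 d) x p.1)) ≤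
        ENNReal.ofReal C * edist p.1 p.2 := by
  obtain ⟨ρ, ρ_pos, hρ⟩ := EMetric.mem_nhds_iff.1 (inter_mem
    (eventually_tangentNorm_mfderiv_extChartAt_le (d := d) x hC)
    (chart_source_mem_nhds (EuclideanSpace ℝ (Fin d)) x))
  -- A path of length below `2ε` starting within `ε` of `x` stays within `3ε` of `x`.
  obtain ⟨ε, ε_pos, hε⟩ : ∃ ε : ℝ≥0∞, 0 < ε ∧ 3 * ε ≤ ρ :=
    ⟨ρ / 3, ENNReal.div_pos ρ_pos.ne' (by simp), ENNReal.mul_div_le⟩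
  have A : Metric.eball x ε ∈ 𝓝 x := Metric.eball_mem_nhds x ε_pos
  filter_upwards [prod_mem_prod A A] with ⟨p, q⟩ ⟨hp, hq⟩
  dsimp only at hp hq ⊢
  set e := extChartAt (𝓡 d) x with he
  have hpq : edist p q < 2 * ε := by
    calc edist p q ≤ edist p x + edist q x := edist_triangle_right p q x
      _ < ε + ε := ENNReal.add_lt_add hp hq
      _ = 2 * ε := (two_mul ε).symm
  suffices H : ∀ r, edist p q < r → r < 2 * ε →
      ENNReal.ofReal (tangentNorm x (e q - e p)) ≤ ENNReal.ofReal C * r by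
    have hlim : Tendsto (fun r ↦ ENNReal.ofReal C * r) (𝓝[>] edist p q)
        (𝓝 (ENNReal.ofReal C * edist p q)) :=
      (ENNReal.Tendsto.const_mul tendsto_id (Or.inr ENNReal.ofReal_ne_top)).mono_left
        nhdsWithin_le_nhds
    have : (𝓝[>] edist p q).NeBot := nhdsGT_neBot_of_exists_gt ⟨_, hpq⟩
    refine ge_of_tendsto hlim ?_
    filter_upwards [Ioo_mem_nhdsGT hpq] with r hr using H r hr.1 hr.2
  intro r hr hr'
  rw [IsRiemannianManifold.out (I := 𝓡 d) p q] at hr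
  obtain ⟨γ, hγ0, hγ1, γ_smooth, hγ, -⟩ := exists_lt_locally_constant_of_riemannianEDist_lt hr zero_lt_one
  have hγ_mem : ∀ t ∈ Icc (0 : ℝ) 1, γ t ∈ Metric.eball x ρ := by
    intro t ht
    have h1 : edist p (γ t) < 2 * ε := by
      rw [IsRiemannianManifold.out (I := 𝓡 d) p (γ t)]
      calc _ ≤ pathELength (𝓡 d) γ 0 t :=
            riemannianEDist_le_pathELength γ_smooth.contMDiffOn hγ0 rfl ht.1
        _ ≤ pathELength (𝓡 d) γ 0 1 := pathELength_mono le_rfl ht.2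
        _ < 2 * ε := hγ.trans hr'
    calc edist (γ t) x ≤ edist (γ t) p + edist p x := edist_triangle _ _ _
      _ < 2 * ε + ε := ENNReal.add_lt_add (by rwa [edist_comm]) hp
      _ = 3 * ε := by ring
      _ ≤ ρ := hε
  let g : ℝ → TangentSpace (𝓡 d) x := fun t ↦ toTangent d x (e (γ t))
  have g_smooth0 : ContMDiffOn 𝓘(ℝ, ℝ) 𝓘(ℝ, EuclideanSpace ℝ (Fin d)) 1 (e ∘ γ) (Icc 0 1) :=
    contMDiffOn_extChartAt.comp (I' := 𝓡 d) γ_smooth.contMDiffOn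
      (fun t ht ↦ (hρ (hγ_mem t ht)).2)
  rw [contMDiffOn_iff_contDiffOn] at g_smooth0
  have g_smooth : ContDiffOn ℝ 1 g (Icc 0 1) :=
    (toTangent d x).contDiff.comp_contDiffOn g_smooth0
  have hder : ∀ t ∈ Icc (0 : ℝ) 1, derivWithin g (Icc 0 1) t = toTangent d x
      (mfderiv (𝓡 d) 𝓘(ℝ, EuclideanSpace ℝ (Fin d)) e (γ t)
        (mfderivWithin 𝓘(ℝ, ℝ) (𝓡 d) γ (Icc 0 1) t 1)) := by
    intro t ht
    have hu := uniqueDiffOn_Icc (zero_lt_one (α := ℝ)) t ht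
    have hcomp : mfderivWithin 𝓘(ℝ, ℝ) 𝓘(ℝ, EuclideanSpace ℝ (Fin d)) (e ∘ γ) (Icc 0 1) t =
        (mfderiv (𝓡 d) 𝓘(ℝ, EuclideanSpace ℝ (Fin d)) e (γ t)) ∘L
          (mfderivWithin 𝓘(ℝ, ℝ) (𝓡 d) γ (Icc 0 1) t) := by
      apply mfderiv_comp_mfderivWithin
      · exact mdifferentiableAt_extChartAt (hρ (hγ_mem t ht)).2
      · exact (γ_smooth.mdifferentiable one_ne_zero).mdifferentiableOn _ ht
      · rwa [uniqueMDiffWithinAt_iff_uniqueDiffWithinAt]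
    rw [mfderivWithin_eq_fderivWithin] at hcomp
    have h2 : HasDerivWithinAt (e ∘ γ) (fderivWithin ℝ (e ∘ γ) (Icc 0 1) t 1) (Icc 0 1) t :=
      ((g_smooth0.differentiableOn one_ne_zero) t ht).hasFDerivWithinAt.hasDerivWithinAt
    have h3 : HasDerivWithinAt g (toTangent d x (fderivWithin ℝ (e ∘ γ) (Icc 0 1) t 1))
        (Icc 0 1) t := (toTangent d x).hasFDerivAt.comp_hasDerivWithinAt t h2
    rw [h3.derivWithin hu]
    exact congrArg (fun L ↦ toTangent d x (L 1)) hcomp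
  have main : ‖g 1 - g 0‖ₑ ≤ ENNReal.ofReal C * r := by
    calc ‖g 1 - g 0‖ₑ
      _ ≤ ∫⁻ t in Icc 0 1, ‖derivWithin g (Icc 0 1) t‖ₑ :=
        enorm_sub_le_lintegral_derivWithin_Icc_of_contDiffOn_Icc g_smooth zero_le_one
      _ ≤ ∫⁻ t in Icc (0 : ℝ) 1,
          ENNReal.ofReal C * ‖mfderivWithin 𝓘(ℝ, ℝ) (𝓡 d) γ (Icc 0 1) t 1‖ₑ := by
        apply MeasureTheory.setLIntegral_mono' measurableSet_Icc (fun t ht ↦ ?_)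
        rw [hder t ht, ← ofReal_norm, ← ofReal_norm,
          ← ENNReal.ofReal_mul (by linarith)]
        exact ENNReal.ofReal_le_ofReal ((hρ (hγ_mem t ht)).1 _)
      _ = ENNReal.ofReal C * pathELength (𝓡 d) γ 0 1 := by
        rw [MeasureTheory.lintegral_const_mul' _ _ ENNReal.ofReal_ne_top,
          pathELength_eq_lintegral_mfderivWithin_Icc]
      _ ≤ _ := by gcongr
  have : ‖g 1 - g 0‖ₑ = ENNReal.ofReal (tangentNorm x (e q - e p)) := by
    rw [← ofReal_norm, tangentNorm_eq_norm_toTangent, map_sub]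
    simp only [g, hγ0, hγ1]
  rwa [← this]

end RiemannianDistance

/-! ### Linearization of a `C^1` map in charts -/

section Linearization

variable {d : ℕ} {M : Type*} [TopologicalSpace M] [ChartedSpace (EuclideanSpace ℝ (Fin d)) M]
  [IsManifold (𝓡 d) ∞ M] [RiemannianBundle (fun x : M ↦ TangentSpace (𝓡 d) x)]

lemma exists_norm_le_tangentNorm (x : M) :
    ∃ K : ℝ, 0 < K ∧ ∀ v : EuclideanSpace ℝ (Fin d), ‖v‖ ≤ K * tangentNorm x v := by
  let L : TangentSpace (𝓡 d) x →L[ℝ] EuclideanSpace ℝ (Fin d) :=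
    show EuclideanSpace ℝ (Fin d) →L[ℝ] EuclideanSpace ℝ (Fin d) from
      ContinuousLinearMap.id ℝ (EuclideanSpace ℝ (Fin d))
  refine ⟨‖L‖ + 1, by positivity, fun v ↦ ?_⟩
  refine (L.le_opNorm (toTangent d x v)).trans ?_
  rw [tangentNorm_eq_norm_toTangent]
  gcongr
  linarith

/-- A `C^1` map is strictly differentiable: the error is small relative to the distance between two
moving points, and not only relative to their distance to `x`. This gives one linear model for all
small balls near `x`. -/
lemma eventually_norm_sub_mfderiv_le {F : M → M} {x : M}
    (hF : ContMDiffAt (𝓡 d) (𝓡 d) 1 F x) {δ : ℝ} (hδ : 0 < δ) :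
    ∀ᶠ p in 𝓝 x ×ˢ 𝓝 x,
      ‖toTangent d (F x) (extChartAt (𝓡 d) (F x) (F p.2) - extChartAt (𝓡 d) (F x) (F p.1)) -
        mfderiv (𝓡 d) (𝓡 d) F x
          (toTangent d x (extChartAt (𝓡 d) x p.2 - extChartAt (𝓡 d) x p.1))‖ ≤
        δ * tangentNorm x (extChartAt (𝓡 d) x p.2 - extChartAt (𝓡 d) x p.1) := by
  set e := extChartAt (𝓡 d) x with he
  set e' := extChartAt (𝓡 d) (F x) with he'
  obtain ⟨K, hK, hK'⟩ := exists_norm_le_tangentNorm (d := d) x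
  set g : EuclideanSpace ℝ (Fin d) → EuclideanSpace ℝ (Fin d) := e' ∘ F ∘ e.symm with hg
  have hg1 : ContDiffAt ℝ 1 g (e x) := by
    have := (contMDiffAt_iff.1 hF).2
    rwa [show range (𝓡 d) = (univ : Set (EuclideanSpace ℝ (Fin d))) by simp,
      contDiffWithinAt_univ] at this
  have hstrict : HasStrictFDerivAt g (fderiv ℝ g (e x)) (e x) :=
    hg1.hasStrictFDerivAt one_ne_zero
  have hmf : ∀ v : EuclideanSpace ℝ (Fin d), mfderiv (𝓡 d) (𝓡 d) F x (toTangent d x v) =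
      toTangent d (F x) (fderiv ℝ g (e x) v) := by
    intro v
    have h1 : mfderiv (𝓡 d) (𝓡 d) F x =
        fderivWithin ℝ (writtenInExtChartAt (𝓡 d) (𝓡 d) x F) (range (𝓡 d)) (e x) :=
      (hF.mdifferentiableAt one_ne_zero).mfderiv
    rw [h1]
    have h2 : fderivWithin ℝ (writtenInExtChartAt (𝓡 d) (𝓡 d) x F) (range (𝓡 d)) (e x) =
        fderiv ℝ g (e x) := by
      have : range (𝓡 d) = (univ : Set (EuclideanSpace ℝ (Fin d))) := by simp
      rw [this, fderivWithin_univ]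
      rfl
    exact congrArg (fun L : EuclideanSpace ℝ (Fin d) →L[ℝ] EuclideanSpace ℝ (Fin d) ↦
      toTangent d (F x) (L v)) h2
  have hc : Tendsto (fun p : M × M ↦ (e p.2, e p.1)) (𝓝 x ×ˢ 𝓝 x) (𝓝 (e x, e x)) := by
    rw [nhds_prod_eq]
    have hcx : Tendsto e (𝓝 x) (𝓝 (e x)) := continuousAt_extChartAt (I := 𝓡 d) x
    exact (hcx.comp tendsto_snd).prodMk (hcx.comp tendsto_fst)
  set T := ‖toTangent d (F x)‖ + 1 with hT
  have hT0 : 0 < T := by positivity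
  have hlo := (hstrict.isLittleO.def (c := δ / (T * K)) (by positivity))
  have hsrc : ∀ᶠ y in 𝓝 x, y ∈ e.source := extChartAt_source_mem_nhds (I := 𝓡 d) x
  filter_upwards [hc.eventually hlo, hsrc.prod_mk hsrc] with ⟨p, q⟩ h ⟨hp, hq⟩
  dsimp only at h hp hq ⊢
  have hgp : g (e p) = e' (F p) := by simp [g, e.left_inv hp]
  have hgq : g (e q) = e' (F q) := by simp [g, e.left_inv hq]
  rw [hgp, hgq] at h
  rw [hmf, ← map_sub]
  calc _ ≤ T * ‖e' (F q) - e' (F p) - fderiv ℝ g (e x) (e q - e p)‖ := by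
        refine ((toTangent d (F x)).le_opNorm _).trans ?_
        gcongr
        linarith
    _ ≤ T * (δ / (T * K) * (K * tangentNorm x (e q - e p))) := by
        gcongr
        exact h.trans (by gcongr; exact hK' _)
    _ = _ := by field_simp

end Linearization

/-! ### Jacobians, singular values and grids adapted to a linear map -/

section LinearAlgebra

open Module

variable {V W X : Type*} [NormedAddCommGroup V] [InnerProductSpace ℝ V] [FiniteDimensional ℝ V]
  [NormedAddCommGroup W] [InnerProductSpace ℝ W] [FiniteDimensional ℝ W]
  [NormedAddCommGroup X] [InnerProductSpace ℝ X] [FiniteDimensional ℝ X]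

lemma jacobianOn_eq_normDet (A : V →ₗ[ℝ] W) (S : Submodule ℝ V) :
    jacobianOn A S = (A.domRestrict S).normDet := by
  rw [jacobianOn, ← LinearMap.normDet_sq]
  exact Real.sqrt_sq (LinearMap.normDet_nonneg _)

lemma jacobianOn_nonneg (A : V →ₗ[ℝ] W) (S : Submodule ℝ V) : 0 ≤ jacobianOn A S :=
  Real.sqrt_nonneg _

lemma jacobianOn_comp (B : W →ₗ[ℝ] X) (A : V →ₗ[ℝ] W) (S : Submodule ℝ V) :
    jacobianOn (B ∘ₗ A) S = jacobianOn B (S.map A) * jacobianOn A S := by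
  simp only [jacobianOn_eq_normDet]
  have h : (B ∘ₗ A).domRestrict S = B ∘ₗ A.domRestrict S := rfl
  have h' : ∀ R : Submodule ℝ W, R = S.map A →
      (B.domRestrict R).normDet = (B.domRestrict (S.map A)).normDet := by
    rintro R rfl; rfl
  rw [h, LinearMap.normDet_comp, h' _ (LinearMap.range_domRestrict _ _)]

/-- The Jacobian is the product of the singular values of the restriction, each being the norm of
the image of a unit eigenvector. -/
lemma jacobianOn_le_pow (A : V →ₗ[ℝ] W) {c : ℝ} (hc : ∀ v, ‖A v‖ ≤ c * ‖v‖)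
    (S : Submodule ℝ V) : jacobianOn A S ≤ c ^ finrank ℝ S := by
  rw [jacobianOn_eq_normDet, LinearMap.normDet_eq_prod_singularValues,
    ← Fin.prod_univ_eq_prod_range]
  refine (Finset.prod_le_prod (g := fun _ ↦ c)
    (fun i _ ↦ LinearMap.singularValues_nonneg _ _) fun i _ ↦ ?_).trans_eq (by simp)
  set B := A.domRestrict S
  set v := B.isSymmetric_adjoint_comp_self.eigenvectorBasis rfl i
  have hv : ‖v‖ = 1 := (B.isSymmetric_adjoint_comp_self.eigenvectorBasis rfl).orthonormal.1 i
  have h1 : ‖B v‖ ^ 2 = B.singularValues i ^ 2 := by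
    rw [← real_inner_self_eq_norm_sq, ← LinearMap.adjoint_inner_left,
      ← LinearMap.comp_apply, B.isSymmetric_adjoint_comp_self.apply_eigenvectorBasis,
      B.sq_singularValues_fin rfl, inner_smul_left, real_inner_self_eq_norm_sq, hv]
    simp
  rw [sq_eq_sq₀ (norm_nonneg _) (B.singularValues_nonneg i)] at h1
  rw [← h1]
  exact (hc v).trans_eq (by rw [show ‖(v : V)‖ = 1 from hv, mul_one])

/-- The Gram matrix of the images is diagonal. This converts bounds on Jacobians into bounds on
products of singular values. -/
lemma jacobianOn_span_eq_prod {ι : Type*} [DecidableEq ι] [DecidableEq V] (A : V →ₗ[ℝ] W) {b : ι → V}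
    (hb : Orthonormal ℝ b) (hA : Pairwise fun i j ↦ inner ℝ (A (b i)) (A (b j)) = 0)
    (T : Finset ι) :
    jacobianOn A (Submodule.span ℝ (T.image b : Set V)) = ∏ i ∈ T, ‖A (b i)‖ := by
  set c := OrthonormalBasis.span hb T
  rw [jacobianOn_eq_normDet, ← sq_eq_sq₀ (LinearMap.normDet_nonneg _)
    (Finset.prod_nonneg fun _ _ ↦ norm_nonneg _)]
  have h := LinearMap.normDet_sq_eq_det_gram (A.domRestrict (Submodule.span ℝ (T.image b : Set V))) c
  have hc : ∀ i : T, (c i : V) = b i := fun i ↦ OrthonormalBasis.span_apply hb T i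
  have hdiag : Matrix.gram ℝ (fun i ↦ A.domRestrict (Submodule.span ℝ (T.image b : Set V)) (c i)) =
      Matrix.diagonal fun i : T ↦ ‖A (b i)‖ ^ 2 := by
    ext i j
    rw [Matrix.gram_apply, LinearMap.domRestrict_apply, LinearMap.domRestrict_apply, hc, hc,
      Matrix.diagonal_apply]
    split_ifs with hij
    · rw [hij, real_inner_self_eq_norm_sq]
    · exact hA fun h ↦ hij (Subtype.ext h)
  rw [hdiag, Matrix.det_diagonal] at h
  have h' : (A.domRestrict (Submodule.span ℝ (T.image b : Set V))).normDet ^ 2 =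
      ∏ i : T, ‖A (b i)‖ ^ 2 := h
  rw [h', ← Finset.prod_pow, ← Finset.prod_coe_sort T]

lemma finrank_span_image_orthonormal {ι : Type*} [DecidableEq V] {b : ι → V}
    (hb : Orthonormal ℝ b) (T : Finset ι) :
    finrank ℝ (Submodule.span ℝ (T.image b : Set V)) = T.card := by
  rw [finrank_eq_card_basis (OrthonormalBasis.span hb T).toBasis, Fintype.card_coe]

/-- An orthonormal basis whose image under a linear map is orthogonal. -/
lemma exists_orthonormalBasis_image_orthogonal {d : ℕ} (hd : finrank ℝ V = d) (A : V →ₗ[ℝ] W) :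
    ∃ b : OrthonormalBasis (Fin d) ℝ V,
      Pairwise fun i j ↦ inner ℝ (A (b i)) (A (b j)) = 0 := by
  refine ⟨A.isSymmetric_adjoint_comp_self.eigenvectorBasis hd, fun i j hij ↦ ?_⟩
  dsimp only
  rw [← LinearMap.adjoint_inner_left, ← LinearMap.comp_apply,
    A.isSymmetric_adjoint_comp_self.apply_eigenvectorBasis, inner_smul_left,
    (A.isSymmetric_adjoint_comp_self.eigenvectorBasis hd).orthonormal.2 hij, mul_zero]

/-- Choice of a dyadic scale at which at most `k` of the numbers `s i` are large. -/
lemma exists_dyadic_scale {d k : ℕ} (hk : 1 ≤ k) {Λ : ℝ} (hΛ : 1 ≤ Λ) (s : Fin d → ℝ)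
    (hT : ∀ T : Finset (Fin d), T.Nonempty → T.card ≤ k → ∏ i ∈ T, s i ≤ Λ) :
    ∃ q : ℕ, (2 : ℝ) ^ q ≤ 2 * Λ ∧ ∏ i, max (s i / 2 ^ q) 1 ≤ 2 ^ k * Λ / 2 ^ (k * q) := by
  classical
  have hT' : ∀ T : Finset (Fin d), T.card ≤ k → ∏ i ∈ T, s i ≤ Λ := by
    intro T h
    rcases T.eq_empty_or_nonempty with rfl | hne
    · simpa using hΛ
    · exact hT T hne h
  have hs : ∀ i, s i ≤ Λ := fun i ↦ by simpa using hT' {i} (by simpa using hk)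
  let S : ℕ → Finset (Fin d) := fun q ↦ Finset.univ.filter fun i ↦ (2 : ℝ) ^ q < s i
  have hex : ∃ q, (S q).card ≤ k := by
    obtain ⟨q, hq⟩ := pow_unbounded_of_one_lt Λ (one_lt_two (α := ℝ))
    refine ⟨q, ?_⟩
    have : S q = ∅ := Finset.filter_eq_empty_iff.2 fun i _ ↦ not_lt.2 ((hs i).trans hq.le)
    simp [this]
  have hmax : ∀ (q : ℕ) (T : Finset (Fin d)), S q ⊆ T →
      ∏ i, max (s i / 2 ^ q) 1 = ∏ i ∈ T, max (s i / 2 ^ q) 1 := by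
    intro q T hST
    refine (Finset.prod_subset (Finset.subset_univ T) fun i _ hi ↦ ?_).symm
    apply max_eq_right
    rw [div_le_one (by positivity)]
    by_contra! h
    exact hi (hST (by simpa [S] using h))
  refine ⟨Nat.find hex, ?_, ?_⟩
  -- The scale is the least `q` for which at most `k` of the `s i` exceed `2 ^ q`.
  · rcases h : Nat.find hex with _ | m
    · simp; linarith
    · have hm := Nat.find_min hex (m := m) (by omega)
      obtain ⟨i, hi⟩ : (S m).Nonempty := by
        rw [← Finset.card_pos]; omega
      have := hs i
      simp only [S, Finset.mem_filter, Finset.mem_univ, true_and] at hi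
      rw [pow_succ]
      linarith
  · have hspec := Nat.find_spec hex
    rcases h : Nat.find hex with _ | m
    · rw [h] at hspec
      rw [hmax 0 (S 0) subset_rfl]
      calc ∏ i ∈ S 0, max (s i / 2 ^ 0) 1 = ∏ i ∈ S 0, s i := by
            refine Finset.prod_congr rfl fun i hi ↦ ?_
            simp only [S, Finset.mem_filter, Finset.mem_univ, true_and, pow_zero] at hi
            simp [hi.le]
        _ ≤ Λ := hT' _ hspec
        _ ≤ 2 ^ k * Λ / 2 ^ (k * 0) := by
            have : (1 : ℝ) ≤ 2 ^ k := one_le_pow₀ one_le_two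
            simp; nlinarith
    · rw [h] at hspec
      have hm := Nat.find_min hex (m := m) (by omega)
      -- By minimality more than `k` numbers exceed `2 ^ m`. Enlarging `S (m + 1)` inside `S m` to
      -- exactly `k` indices produces the full power `2 ^ (k * m)`; the factor `2 ^ k` in the bound
      -- pays for passing from `m` to `m + 1`.
      obtain ⟨T, hT1, hT2, hTk⟩ := Finset.exists_subsuperset_card_eq
        (show S (m + 1) ⊆ S m from fun i hi ↦ by
          simp only [S, Finset.mem_filter, Finset.mem_univ, true_and] at hi ⊢
          exact (pow_le_pow_right₀ one_le_two (Nat.le_succ m)).trans_lt hi) hspec (not_le.1 hm).le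
      rw [hmax _ T hT1]
      calc ∏ i ∈ T, max (s i / 2 ^ (m + 1)) 1 ≤ ∏ i ∈ T, s i / 2 ^ m := by
            refine Finset.prod_le_prod (fun i _ ↦ by positivity) fun i hi ↦ ?_
            have hi := hT2 hi
            simp only [S, Finset.mem_filter, Finset.mem_univ, true_and] at hi
            have h0 : 0 < s i := lt_trans (by positivity) hi
            refine max_le ?_ ?_
            · gcongr
              · exact one_le_two
              · omega
            · rw [one_le_div (by positivity)]; exact hi.le
        _ = (∏ i ∈ T, s i) / 2 ^ (k * m) := by
            rw [Finset.prod_div_distrib, Finset.prod_const, hTk, ← pow_mul, mul_comm]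
        _ ≤ Λ / 2 ^ (k * m) := by gcongr; exact hT' T hTk.le
        _ = _ := by
            rw [mul_add, pow_add, mul_one]
            field_simp

/-- The image of a ball under a linear map, cut into small classes. If the Jacobians of `A` on the
subspaces of dimension at most `k` are bounded by `Λ`, there is a scale `2 ^ q` at which
the number of classes is of order `Λ / 2 ^ (k * q)`. -/
lemma exists_linear_classes {d k : ℕ} (hd : finrank ℝ V = d) (hk : 1 ≤ k) {Λ : ℝ} (hΛ : 1 ≤ Λ)
    (A : V →ₗ[ℝ] W)
    (hA : ∀ S : Submodule ℝ V, 1 ≤ finrank ℝ S → finrank ℝ S ≤ k → jacobianOn A S ≤ Λ) :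
    ∃ q : ℕ, (2 : ℝ) ^ q ≤ 2 * Λ ∧ ∀ r : ℝ, 0 < r →
      ∃ (κ : V → Fin d → ℤ) (T : Finset (Fin d → ℤ)),
        (T.card : ℝ) ≤ (34 * d) ^ d * (2 ^ k * Λ / 2 ^ (k * q)) ∧
        (∀ v, ‖v‖ ≤ 2 * r → κ v ∈ T) ∧
        ∀ v w, κ v = κ w → ‖A v - A w‖ ≤ 2 ^ q * r / 8 := by
  classical
  obtain ⟨b, hb⟩ := exists_orthonormalBasis_image_orthogonal hd A
  obtain ⟨q, hq, hprod⟩ := exists_dyadic_scale hk hΛ (fun i ↦ ‖A (b i)‖) (by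
    intro T hne hT
    rw [← jacobianOn_span_eq_prod A b.orthonormal hb T]
    apply hA
    · rw [finrank_span_image_orthonormal b.orthonormal]; exact hne.card_pos
    · rwa [finrank_span_image_orthonormal b.orthonormal])
  refine ⟨q, hq, fun r hr ↦ ?_⟩
  set σ : Fin d → ℝ := fun i ↦ max (‖A (b i)‖ / 2 ^ q) 1 with hσ
  have hσ1 : ∀ i, 1 ≤ σ i := fun i ↦ le_max_right _ _
  have hd1 : ∀ _ : Fin d, (1 : ℝ) ≤ d := fun i ↦ by exact_mod_cast i.pos
  -- Sides of the grid boxes along the singular directions: `A` stretches side `i` to at most `2 ^ q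
  -- * r / (8 * d)`, and the `d` sides add up to `2 ^ q * r / 8`. The coordinates of a vector of
  -- norm at most `2 * r` are at most `16 * d * σ i` in units of `τ i`.
  set τ : Fin d → ℝ := fun i ↦ r / (8 * d * σ i) with hτ
  have hτ0 : ∀ i, 0 < τ i := fun i ↦ by
    have := hσ1 i
    have := hd1 i
    positivity
  refine ⟨fun v i ↦ ⌊inner ℝ (b i) v / τ i⌋,
    Fintype.piFinset fun i ↦ Finset.Icc ⌊-(16 * d * σ i)⌋ ⌊16 * d * σ i⌋, ?_, ?_, ?_⟩
  · rw [Fintype.card_piFinset, Nat.cast_prod]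
    calc _ ≤ ∏ i : Fin d, (34 * d) * σ i := by
          refine Finset.prod_le_prod (fun i _ ↦ by positivity) fun i _ ↦ ?_
          rw [Int.card_Icc]
          have hx : 1 ≤ d * σ i := one_le_mul_of_one_le_of_one_le (hd1 i) (hσ1 i)
          have h1 : ((⌊16 * d * σ i⌋ + 1 - ⌊-(16 * d * σ i)⌋ : ℤ) : ℝ) ≤ 34 * d * σ i := by
            push_cast
            have := Int.floor_le (16 * d * σ i)
            have := Int.lt_floor_add_one (-(16 * d * σ i))
            linarith
          have h2 : (0 : ℤ) ≤ ⌊16 * d * σ i⌋ + 1 - ⌊-(16 * d * σ i)⌋ := by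
            have : ⌊-(16 * d * σ i)⌋ ≤ ⌊16 * d * σ i⌋ := Int.floor_le_floor (by linarith)
            omega
          rw [← Int.toNat_of_nonneg h2] at h1
          exact_mod_cast h1
      _ = (34 * d) ^ d * ∏ i, σ i := by
          rw [Finset.prod_mul_distrib, Finset.prod_const, Finset.card_univ, Fintype.card_fin]
      _ ≤ _ := by gcongr
  · intro v hv
    rw [Fintype.mem_piFinset]
    intro i
    have h1 : |inner ℝ (b i) v| ≤ 2 * r := by
      refine (abs_real_inner_le_norm _ _).trans ?_
      rw [b.orthonormal.1 i, one_mul]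
      exact hv
    have h2 : |inner ℝ (b i) v / τ i| ≤ 16 * d * σ i := by
      rw [abs_div, abs_of_pos (hτ0 i), div_le_iff₀ (hτ0 i)]
      refine h1.trans_eq ?_
      have := hσ1 i
      have := hd1 i
      simp only [hτ]
      field_simp
      norm_num
    rw [abs_le] at h2
    exact Finset.mem_Icc.2 ⟨Int.floor_le_floor h2.1, Int.floor_le_floor h2.2⟩
  · intro v w hvw
    have hc : ∀ i, |inner ℝ (b i) (v - w)| ≤ τ i := by
      intro i
      have := Int.abs_sub_lt_one_of_floor_eq_floor (congrFun hvw i)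
      rw [← sub_div, abs_div, abs_of_pos (hτ0 i), div_lt_one (hτ0 i), ← inner_sub_right] at this
      exact this.le
    rw [← map_sub, ← b.sum_repr' (v - w), map_sum]
    calc ‖∑ i, A (inner ℝ (b i) (v - w) • b i)‖
        ≤ ∑ i, ‖A (inner ℝ (b i) (v - w) • b i)‖ := norm_sum_le _ _
      _ ≤ ∑ _i : Fin d, 2 ^ q * r / (8 * d) := by
          refine Finset.sum_le_sum fun i _ ↦ ?_
          rw [map_smul, norm_smul, Real.norm_eq_abs]
          have h1 := hσ1 i
          have h3 := hd1 i
          have h2 : ‖A (b i)‖ ≤ 2 ^ q * σ i := by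
            have : ‖A (b i)‖ / 2 ^ q ≤ σ i := le_max_left _ _
            rwa [div_le_iff₀' (by positivity)] at this
          calc _ ≤ τ i * (2 ^ q * σ i) := by gcongr; exact hc i
            _ = _ := by simp only [hτ]; field_simp
      _ ≤ 2 ^ q * r / 8 := by
          rw [Finset.sum_const, Finset.card_univ, Fintype.card_fin, nsmul_eq_mul]
          rcases Nat.eq_zero_or_pos d with rfl | h
          · simp; positivity
          · have : (0 : ℝ) < d := by exact_mod_cast h
            apply le_of_eq
            field_simp

end LinearAlgebra

/-! ### Counting orbit cells by itineraries of exponents -/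

section Itineraries

variable {X : Type*}

/-- The points whose first symbols along the orbit under `F`, as given by `q`, are those of the
list. -/
def itinerarySet (F : X → X) (q : X → ℕ) : List ℕ → Set X
  | [] => univ
  | m :: h => {x | q x = m} ∩ F ⁻¹' itinerarySet F q h

lemma mem_itinerarySet_ofFn (F : X → X) (q : X → ℕ) (n : ℕ) (x : X) :
    x ∈ itinerarySet F q (List.ofFn fun j : Fin n ↦ q (F^[j] x)) := by
  induction n generalizing x with
  | zero => simp [itinerarySet]
  | succ n ih =>
    rw [List.ofFn_succ]
    refine ⟨by simp, ?_⟩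
    simpa using! ih (F x)

/-- A family of sets on which the orbits of length `n` under `F` stay `ε`-close. -/
def IsOrbitCell [PseudoEMetricSpace X] (F : X → X) (ε : ℝ≥0∞) (n : ℕ) (W : Set X) : Prop :=
  ∀ x ∈ W, ∀ y ∈ W, ∀ j ≤ n, edist (F^[j] x) (F^[j] y) < ε

variable [PseudoEMetricSpace X]

/-- `F` maps the points with symbol `m` of a ball of radius `r ≤ r₀` into at most `Γ / 2 ^ (k * m)`
balls of radius `2 ^ m * r`. -/
def HasBallExpansion (F : X → X) (q : X → ℕ) (k : ℕ) (Γ r₀ : ℝ) : Prop :=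
  ∀ (c : X) (m : ℕ) (r : ℝ), 0 < r → r ≤ r₀ → ∃ T : Finset X, (T.card : ℝ) ≤ Γ / 2 ^ (k * m) ∧
    ∀ x ∈ Metric.eball c (ENNReal.ofReal r), q x = m →
      ∃ z ∈ T, F x ∈ Metric.eball z (ENNReal.ofReal (2 ^ m * r))

lemma edist_lt_of_mem_eball {c x y : X} {r r₀ : ℝ} (hr : r ≤ r₀)
    (hx : x ∈ Metric.eball c (ENNReal.ofReal r)) (hy : y ∈ Metric.eball c (ENNReal.ofReal r)) :
    edist x y < 2 * ENNReal.ofReal r₀ := by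
  have hx' : edist x c < ENNReal.ofReal r₀ := lt_of_lt_of_le hx (ENNReal.ofReal_le_ofReal hr)
  have hy' : edist y c < ENNReal.ofReal r₀ := lt_of_lt_of_le hy (ENNReal.ofReal_le_ofReal hr)
  calc edist x y ≤ edist x c + edist y c := edist_triangle_right _ _ _
    _ < _ := by rw [two_mul]; exact ENNReal.add_lt_add hx' hy'

/-- By induction on the itinerary: cover the image of the ball by larger balls, cut each of these
into cells, pull the cells back and intersect with the ball. The hypothesis on `ρ` keeps the grown
radii below `r₀`. -/
lemma HasBallExpansion.exists_cells {F : X → X} {q : X → ℕ} {k : ℕ} {Γ r₀ : ℝ}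
    (hΓ : 0 ≤ Γ) (hF : HasBallExpansion F q k Γ r₀) (h : List ℕ) (c : X) (ρ : ℝ)
    (hρ : 0 < ρ) (hρ' : ρ * 2 ^ h.sum ≤ r₀) :
    ∃ 𝒲 : Finset (Set X), (𝒲.card : ℝ) ≤ Γ ^ h.length / 2 ^ (k * h.sum) ∧
      Metric.eball c (ENNReal.ofReal ρ) ∩ itinerarySet F q h ⊆ ⋃₀ 𝒲 ∧
      ∀ W ∈ 𝒲, IsOrbitCell F (2 * ENNReal.ofReal r₀) h.length W := by
  classical
  induction h generalizing c ρ with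
  | nil =>
    refine ⟨{Metric.eball c (ENNReal.ofReal ρ)}, by simp, by simp, ?_⟩
    intro W hW x hx y hy j hj
    simp only [Finset.mem_singleton] at hW
    subst hW
    obtain rfl : j = 0 := by simpa using hj
    exact edist_lt_of_mem_eball (by simpa using hρ') hx hy
  | cons m h ih =>
    have hρr : ρ ≤ r₀ := by
      refine le_trans ?_ hρ'
      exact le_mul_of_one_le_right hρ.le (one_le_pow₀ one_le_two)
    obtain ⟨T, hT, hT'⟩ := hF c m ρ hρ hρr
    have h2 : 2 ^ m * ρ * 2 ^ h.sum ≤ r₀ := by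
      rw [List.sum_cons, pow_add] at hρ'
      linarith
    choose 𝒱 h𝒱1 h𝒱2 h𝒱3 using fun z ↦ ih z (2 ^ m * ρ) (by positivity) h2
    refine ⟨T.biUnion fun z ↦ (𝒱 z).image fun W ↦ F ⁻¹' W ∩ Metric.eball c (ENNReal.ofReal ρ),
      ?_, ?_, ?_⟩
    · calc _ ≤ ∑ z ∈ T, ((𝒱 z).card : ℝ) := by
            rw [← Nat.cast_sum]
            exact_mod_cast Finset.card_biUnion_le.trans
              (Finset.sum_le_sum fun z _ ↦ Finset.card_image_le)
        _ ≤ ∑ _z ∈ T, Γ ^ h.length / 2 ^ (k * h.sum) := Finset.sum_le_sum fun z _ ↦ h𝒱1 z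
        _ = T.card * (Γ ^ h.length / 2 ^ (k * h.sum)) := by rw [Finset.sum_const, nsmul_eq_mul]
        _ ≤ Γ / 2 ^ (k * m) * (Γ ^ h.length / 2 ^ (k * h.sum)) := by
            gcongr
        _ = _ := by
            rw [List.length_cons, List.sum_cons, mul_add, pow_add (2 : ℝ), pow_succ' Γ h.length,
              div_mul_div_comm]
    · rintro x ⟨hx, hxm, hxh⟩
      obtain ⟨z, hz, hxz⟩ := hT' x hx hxm
      obtain ⟨W, hW, hxW⟩ := h𝒱2 z ⟨hxz, hxh⟩
      refine ⟨F ⁻¹' W ∩ Metric.eball c (ENNReal.ofReal ρ), ?_, hxW, hx⟩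
      simp only [Finset.coe_biUnion, mem_iUnion, Finset.coe_image]
      exact ⟨z, hz, W, hW, rfl⟩
    · intro W hW
      simp only [Finset.mem_biUnion, Finset.mem_image] at hW
      obtain ⟨z, hz, W, hW, rfl⟩ := hW
      rintro x ⟨hxW, hx⟩ y ⟨hyW, hy⟩ j hj
      rcases j with _ | j
      · exact edist_lt_of_mem_eball hρr hx hy
      · exact h𝒱3 z W hW (F x) hxW (F y) hyW j (by simpa using hj)

/-- Each itinerary gets its own initial radius `r₀ / 2 ^ h.sum`; the cost of covering `D` at that
radius cancels the denominator in `exists_cells`. The factor `K ^ n` counts the itineraries. -/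
lemma HasBallExpansion.exists_cells_cover {F : X → X} {q : X → ℕ} {k K : ℕ} {Γ r₀ C : ℝ}
    (hr₀ : 0 < r₀) (hΓ : 0 ≤ Γ) (hF : HasBallExpansion F q k Γ r₀) (hq : ∀ x, q x < K)
    {D : Set X} (hD : ∀ ρ : ℝ, 0 < ρ → ρ ≤ r₀ → ∃ T : Finset X, (T.card : ℝ) ≤ C / ρ ^ k ∧
      D ⊆ ⋃ z ∈ T, Metric.eball z (ENNReal.ofReal ρ)) (n : ℕ) :
    ∃ 𝒲 : Finset (Set X), (𝒲.card : ℝ) ≤ C / r₀ ^ k * (K * Γ) ^ n ∧ D ⊆ ⋃₀ 𝒲 ∧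
      ∀ W ∈ 𝒲, IsOrbitCell F (2 * ENNReal.ofReal r₀) n W := by
  classical
  have step : ∀ h : List ℕ, ∃ 𝒲 : Finset (Set X),
      (𝒲.card : ℝ) ≤ C / r₀ ^ k * Γ ^ h.length ∧ D ∩ itinerarySet F q h ⊆ ⋃₀ 𝒲 ∧
      ∀ W ∈ 𝒲, IsOrbitCell F (2 * ENNReal.ofReal r₀) h.length W := by
    intro h
    set ρ := r₀ / 2 ^ h.sum with hρ
    have hρ0 : 0 < ρ := by positivity
    obtain ⟨T, hT, hT'⟩ := hD ρ hρ0 (div_le_self hr₀.le (one_le_pow₀ one_le_two))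
    choose 𝒱 h𝒱1 h𝒱2 h𝒱3 using fun z ↦ hF.exists_cells hΓ h z ρ hρ0 (by
      rw [hρ, div_mul_cancel₀ _ (by positivity)])
    refine ⟨T.biUnion 𝒱, ?_, ?_, ?_⟩
    · calc _ ≤ ∑ z ∈ T, ((𝒱 z).card : ℝ) := by
            rw [← Nat.cast_sum]
            exact_mod_cast Finset.card_biUnion_le
        _ ≤ ∑ _z ∈ T, Γ ^ h.length / 2 ^ (k * h.sum) := Finset.sum_le_sum fun z _ ↦ h𝒱1 z
        _ = T.card * (Γ ^ h.length / 2 ^ (k * h.sum)) := by rw [Finset.sum_const, nsmul_eq_mul]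
        _ ≤ C / ρ ^ k * (Γ ^ h.length / 2 ^ (k * h.sum)) := by
            gcongr
        _ = _ := by
            rw [hρ, div_pow, ← pow_mul, mul_comm k]
            field_simp
    · rintro x ⟨hx, hxh⟩
      obtain ⟨z, hz, hxz⟩ := mem_iUnion₂.1 (hT' hx)
      obtain ⟨W, hW, hxW⟩ := h𝒱2 z ⟨hxz, hxh⟩
      refine ⟨W, ?_, hxW⟩
      simp only [Finset.coe_biUnion, mem_iUnion]
      exact ⟨z, hz, hW⟩
    · intro W hW
      obtain ⟨z, hz, hW⟩ := Finset.mem_biUnion.1 hW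
      exact h𝒱3 z W hW
  choose 𝒱 h𝒱1 h𝒱2 h𝒱3 using step
  refine ⟨(Finset.univ : Finset (Fin n → Fin K)).biUnion fun h ↦
    𝒱 (List.ofFn fun j ↦ (h j : ℕ)), ?_, ?_, ?_⟩
  · calc _ ≤ ∑ h : Fin n → Fin K, ((𝒱 (List.ofFn fun j ↦ (h j : ℕ))).card : ℝ) := by
          rw [← Nat.cast_sum]
          exact_mod_cast Finset.card_biUnion_le
      _ ≤ ∑ _h : Fin n → Fin K, C / r₀ ^ k * Γ ^ n := by
          refine Finset.sum_le_sum fun h _ ↦ ?_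
          simpa using h𝒱1 (List.ofFn fun j ↦ (h j : ℕ))
      _ = _ := by
          rw [Finset.sum_const, nsmul_eq_mul, Finset.card_univ, Fintype.card_fun,
            Fintype.card_fin, Fintype.card_fin, mul_pow]
          push_cast
          ring
  · intro x hx
    obtain ⟨W, hW, hxW⟩ := h𝒱2 _ ⟨hx, mem_itinerarySet_ofFn F q n x⟩
    refine ⟨W, ?_, hxW⟩
    simp only [Finset.coe_biUnion, mem_iUnion]
    exact ⟨fun j ↦ ⟨q (F^[j] x), hq _⟩, by simp, hW⟩
  · intro W hW
    obtain ⟨h, -, hW⟩ := Finset.mem_biUnion.1 hW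
    simpa using h𝒱3 _ W hW

lemma HasBallExpansion.mono {F : X → X} {q : X → ℕ} {k : ℕ} {Γ r₀ r₁ : ℝ}
    (hF : HasBallExpansion F q k Γ r₀) (h : r₁ ≤ r₀) : HasBallExpansion F q k Γ r₁ :=
  fun c m r hr hr' ↦ hF c m r hr (hr'.trans h)

lemma coverMincard_le_card_cells {f : X → X} {N n : ℕ} (hN : 0 < N) {U : Set (X × X)}
    {ε : ℝ≥0∞} (hU : ∀ x y, edist x y < ε → ∀ i < N, (f^[i] x, f^[i] y) ∈ U) {D : Set X}
    {𝒲 : Finset (Set X)} (hD : D ⊆ ⋃₀ 𝒲) (h𝒲 : ∀ W ∈ 𝒲, IsOrbitCell f^[N] ε n W) :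
    coverMincard f D U (N * n) ≤ 𝒲.card := by
  classical
  rcases isEmpty_or_nonempty X with hX | hX
  · rw [Set.eq_empty_of_isEmpty D, coverMincard_empty]
    exact zero_le
  let p : Set X → X := fun W ↦ if h : W.Nonempty then h.some else Classical.arbitrary X
  have hcov : IsDynCoverOf f D U (N * n) (𝒲.image p : Finset X) := by
    intro x hx
    obtain ⟨W, hW, hxW⟩ := hD hx
    refine ⟨p W, by simpa using ⟨W, hW, rfl⟩, ?_⟩
    have hpW : p W ∈ W := by
      have : W.Nonempty := ⟨x, hxW⟩
      simp only [p, dif_pos this]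
      exact this.some_mem
    change (x, p W) ∈ dynEntourage f U (N * n)
    rw [mem_dynEntourage]
    intro l hl
    have hj : l / N ≤ n := (Nat.div_lt_of_lt_mul hl).le
    -- Time `l` is reached by `l / N` steps of `f^[N]`, controlled by the cell, and `l % N` steps of
    -- `f`, controlled by `hU`.
    have key := hU _ _ (h𝒲 W hW x hxW (p W) hpW (l / N) hj) (l % N) (Nat.mod_lt l hN)
    rw [← Function.iterate_mul, ← Function.iterate_add_apply, ← Function.iterate_add_apply,
      Nat.mod_add_div] at key
    exact key
  refine hcov.coverMincard_le_card.trans ?_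
  exact_mod_cast Finset.card_image_le

lemma expGrowthSup_le_of_le_pow_div {u : ℕ → ℝ≥0∞} {B R : ℝ} (hR : 1 ≤ R) {N : ℕ}
    (hB : 0 ≤ B) (hu : ∀ m, u m ≤ ENNReal.ofReal (B * R ^ (m / N + 1))) :
    expGrowthSup u ≤ ENNReal.log (ENNReal.ofReal (R ^ (1 / N : ℝ))) := by
  rw [← expGrowthSup_pow]
  refine expGrowthSup_le_of_eventually_le (b := ENNReal.ofReal (B * R)) ENNReal.ofReal_ne_top
    (Eventually.of_forall fun m ↦ (hu m).trans ?_)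
  have hR0 : 0 ≤ R := zero_le_one.trans hR
  rw [← ENNReal.ofReal_pow (by positivity), ← ENNReal.ofReal_mul (by positivity)]
  apply ENNReal.ofReal_le_ofReal
  rw [pow_succ, mul_comm _ R, ← mul_assoc]
  gcongr
  rw [← Real.rpow_natCast (R ^ _) m, ← Real.rpow_mul hR0, ← Real.rpow_natCast]
  apply Real.rpow_le_rpow_of_exponent_le hR
  rw [one_div, mul_comm, ← div_eq_mul_inv]
  exact Nat.cast_div_le

/-- The entourage only affects the starting radius `r₁`, hence the constant `C / r₁ ^ k`, which has
no effect on the exponential growth rate. -/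
lemma uniformEntropy_le_of_hasBallExpansion [CompactSpace X] {f : X → X} (hf : Continuous f)
    {N : ℕ} (hN : 0 < N) {q : X → ℕ} {k K : ℕ} {Γ r₀ C : ℝ} (hr₀ : 0 < r₀)
    (hΓ : 1 ≤ Γ) (hK : 1 ≤ K) (hC : 0 ≤ C) (hF : HasBallExpansion f^[N] q k Γ r₀)
    (hq : ∀ x, q x < K)
    {𝒟 : Set (Set X)} (h𝒟 : ∀ D ∈ 𝒟, ∀ ρ : ℝ, 0 < ρ → ρ ≤ 1 →
      ∃ T : Finset X, (T.card : ℝ) ≤ C / ρ ^ k ∧ D ⊆ ⋃ z ∈ T, Metric.eball z (ENNReal.ofReal ρ)) :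
    uniformEntropy f 𝒟 ≤ ENNReal.log (ENNReal.ofReal ((K * Γ) ^ (1 / N : ℝ))) := by
  refine iSup₂_le fun U hU ↦ ?_
  obtain ⟨ε, hε, hεU⟩ := mem_uniformity_edist.1
    (dynEntourage_mem_uniformity (CompactSpace.uniformContinuous_of_continuous hf) hU N)
  obtain ⟨r₁, hr₁, hr₁0, hr₁1, hr₁ε⟩ : ∃ r₁ : ℝ, 0 < r₁ ∧ r₁ ≤ r₀ ∧ r₁ ≤ 1 ∧
      2 * ENNReal.ofReal r₁ ≤ ε := by
    obtain ⟨δ, hδ, hδε⟩ : ∃ δ : ℝ, 0 < δ ∧ ENNReal.ofReal δ ≤ ε := by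
      rcases eq_or_ne ε ⊤ with rfl | h
      · exact ⟨1, one_pos, le_top⟩
      · exact ⟨ε.toReal, ENNReal.toReal_pos hε.ne' h, (ENNReal.ofReal_toReal h).le⟩
    refine ⟨min (δ / 2) (min r₀ 1), by positivity,
      (min_le_right _ _).trans (min_le_left _ _), (min_le_right _ _).trans (min_le_right _ _), ?_⟩
    refine le_trans ?_ hδε
    rw [show (2 : ℝ≥0∞) = ENNReal.ofReal 2 by simp, ← ENNReal.ofReal_mul zero_le_two]
    apply ENNReal.ofReal_le_ofReal
    linarith [min_le_left (δ / 2) (min r₀ 1)]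
  have hΓK : 1 ≤ K * Γ := one_le_mul_of_one_le_of_one_le (by exact_mod_cast hK) hΓ
  refine expGrowthSup_le_of_le_pow_div (B := C / r₁ ^ k) hΓK (by positivity) fun m ↦ ?_
  refine iSup₂_le fun D hD ↦ ?_
  obtain ⟨𝒲, h𝒲, hD𝒲, hcell⟩ := (hF.mono hr₁0).exists_cells_cover hr₁ (by linarith) hq
    (fun ρ hρ hρ' ↦ h𝒟 D hD ρ hρ (hρ'.trans hr₁1)) (m / N + 1)
  have hcard : coverMincard f D U m ≤ 𝒲.card := by
    refine (coverMincard_monotone_time f D U (Nat.lt_mul_div_succ m hN).le).trans ?_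
    refine coverMincard_le_card_cells hN (fun x y hxy i hi ↦ ?_) hD𝒲 hcell
    exact mem_dynEntourage.1 (hεU (hxy.trans_le hr₁ε)) i hi
  calc ((coverMincard f D U m : ℕ∞) : ℝ≥0∞) ≤ ((𝒲.card : ℕ∞) : ℝ≥0∞) :=
        ENat.toENNReal_mono hcard
    _ = ENNReal.ofReal 𝒲.card := by simp
    _ ≤ _ := ENNReal.ofReal_le_ofReal h𝒲

lemma tendsto_affine_mul_pow_rpow {c a b Λ : ℝ} (hc : 0 < c) (ha : 0 < a) (hb : 0 ≤ b)
    (hΛ : 0 ≤ Λ) :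
    Tendsto (fun N : ℕ ↦ ((a * N + b) * (c * Λ ^ N)) ^ (1 / N : ℝ)) atTop (𝓝 Λ) := by
  have hlin : Tendsto (fun N : ℕ ↦ c * a * (N : ℝ) + c * b) atTop atTop :=
    tendsto_atTop_add_const_right _ _
      (tendsto_natCast_atTop_atTop.const_mul_atTop (by positivity))
  -- At `y = c * a * N + c * b` the exponent `c * a / (y - c * b)` is `1 / N`.
  have h1 := (tendsto_rpow_div_mul_add (c * a) 1 (-(c * b)) (by norm_num)).comp hlin
  have h2 := h1.mul_const Λ
  rw [one_mul] at h2
  refine h2.congr' ?_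
  filter_upwards [eventually_ge_atTop 1] with N hN
  have hN0 : (N : ℝ) ≠ 0 := by positivity
  simp only [Function.comp_apply]
  have hexp : c * a / (1 * (c * a * N + c * b) + -(c * b)) = 1 / N := by
    field_simp
    ring
  rw [hexp, show (a * N + b) * (c * Λ ^ N) = (c * a * N + c * b) * Λ ^ N by ring,
    Real.mul_rpow (by positivity) (by positivity), ← Real.rpow_natCast Λ, ← Real.rpow_mul hΛ,
    mul_one_div_cancel hN0, Real.rpow_one]

end Itineraries

/-- One point of `S` is chosen in each nonempty class of `κ`; these points serve as centres of
balls. -/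
lemma exists_finset_representatives {α β : Type*} (S : Set α) (κ : α → β) (T : Finset β)
    (hκ : ∀ x ∈ S, κ x ∈ T) :
    ∃ R : Finset α, R.card ≤ T.card ∧ ↑R ⊆ S ∧ ∀ x ∈ S, ∃ y ∈ R, κ x = κ y := by
  classical
  rcases isEmpty_or_nonempty α with hα | hα
  · exact ⟨∅, by simp, by simp, fun x ↦ (hα.false x).elim⟩
  have hfin : (κ '' S).Finite := T.finite_toSet.subset (by rintro _ ⟨x, hx, rfl⟩; exact hκ x hx)
  choose! g hgS hg using fun b (hb : b ∈ κ '' S) ↦ hb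
  refine ⟨hfin.toFinset.image g, ?_, ?_, ?_⟩
  · refine Finset.card_image_le.trans (Finset.card_le_card fun b hb ↦ ?_)
    obtain ⟨x, hx, rfl⟩ := hfin.mem_toFinset.1 hb
    exact hκ x hx
  · intro y hy
    obtain ⟨b, hb, rfl⟩ := Finset.mem_image.1 (Finset.mem_coe.1 hy)
    exact hgS b (hfin.mem_toFinset.1 hb)
  · intro x hx
    have hx' : κ x ∈ κ '' S := ⟨x, hx, rfl⟩
    exact ⟨g (κ x), Finset.mem_image.2 ⟨κ x, hfin.mem_toFinset.2 hx', rfl⟩, (hg _ hx').symm⟩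

/-! ### Ball expansion for `C^1` maps -/

section BallExpansion

open Module

variable {d : ℕ} {M : Type*} [EMetricSpace M] [ChartedSpace (EuclideanSpace ℝ (Fin d)) M]
  [IsManifold (𝓡 d) ∞ M] [RiemannianBundle (fun x : M ↦ TangentSpace (𝓡 d) x)]
  [IsContinuousRiemannianBundle (EuclideanSpace ℝ (Fin d))
      (fun x : M ↦ TangentSpace (𝓡 d) x)] [IsRiemannianManifold (𝓡 d) M]

lemma finrank_tangentSpace (x : M) : finrank ℝ (TangentSpace (𝓡 d) x) = d :=
  (finrank_euclideanSpace_fin : finrank ℝ (EuclideanSpace ℝ (Fin d)) = d)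

/-- Near `x` the map is its derivative up to a small relative error, and the norm at `x` is the
distance up to a factor `2`, so the linear classes of `T_x F` cut the image of every small ball,
whatever its radius. -/
lemma exists_local_ball_expansion {F : M → M} {x : M} (hF : ContMDiffAt (𝓡 d) (𝓡 d) 1 F x)
    {k : ℕ} (hk : 1 ≤ k) {Λ : ℝ} (hΛ : 1 ≤ Λ)
    (hA : ∀ S : Submodule ℝ (TangentSpace (𝓡 d) x), 1 ≤ finrank ℝ S → finrank ℝ S ≤ k →
      jacobianOn (mfderiv (𝓡 d) (𝓡 d) F x :
        TangentSpace (𝓡 d) x →ₗ[ℝ] TangentSpace (𝓡 d) (F x)) S ≤ Λ) :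
    ∃ U ∈ 𝓝 x, ∃ q : ℕ, (2 : ℝ) ^ q ≤ 2 * Λ ∧ ∀ (c : M) (r : ℝ), 0 < r →
      Metric.eball c (ENNReal.ofReal r) ⊆ U → ∃ T : Finset M,
        (T.card : ℝ) ≤ (34 * d) ^ d * 2 ^ k * Λ / 2 ^ (k * q) ∧
        ∀ y ∈ Metric.eball c (ENNReal.ofReal r),
          ∃ z ∈ T, F y ∈ Metric.eball z (ENNReal.ofReal (2 ^ q * r)) := by
  classical
  obtain ⟨q, hq, hcl⟩ := exists_linear_classes (V := TangentSpace (𝓡 d) x)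
    (W := TangentSpace (𝓡 d) (F x)) (finrank_tangentSpace x) hk hΛ
    (mfderiv (𝓡 d) (𝓡 d) F x : TangentSpace (𝓡 d) x →ₗ[ℝ] TangentSpace (𝓡 d) (F x)) hA
  set e := extChartAt (𝓡 d) x with he
  set e' := extChartAt (𝓡 d) (F x) with he'
  set A := mfderiv (𝓡 d) (𝓡 d) F x with hAdef
  have hlow := eventually_tangentNorm_le_edist (d := d) x one_lt_two
  have hlin := eventually_norm_sub_mfderiv_le hF (δ := 1 / 64) (by norm_num)
  have hup := (hF.continuousAt.prodMap' hF.continuousAt).eventually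
    ((nhds_prod_eq (x := F x) (y := F x)) ▸
      eventually_edist_le_tangentNorm (d := d) (F x) one_lt_two)
  rw [nhds_prod_eq] at hup
  obtain ⟨U, hU, hUall⟩ := eventually_prod_self_iff'.1 (hlow.and (hlin.and hup))
  have dist_le : ∀ y ∈ U, ∀ z ∈ U, ∀ r : ℝ, 0 < r → edist y z < 2 * ENNReal.ofReal r →
      tangentNorm x (e z - e y) ≤ 4 * r := by
    intro y hy z hz r hr hyz
    have h1 := (hUall y hy z hz).1
    have h2 : ENNReal.ofReal (tangentNorm x (e z - e y)) ≤ ENNReal.ofReal (4 * r) := by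
      refine h1.trans ?_
      calc ENNReal.ofReal 2 * edist y z ≤ ENNReal.ofReal 2 * (2 * ENNReal.ofReal r) := by
            gcongr
        _ = _ := by
            rw [show (2 : ℝ≥0∞) = ENNReal.ofReal 2 by simp, ← ENNReal.ofReal_mul zero_le_two,
              ← ENNReal.ofReal_mul zero_le_two]
            congr 1; ring
    exact (ENNReal.ofReal_le_ofReal_iff (by positivity)).1 h2
  refine ⟨U, hU, q, hq, fun c r hr hcU ↦ ?_⟩
  have hcc : c ∈ Metric.eball c (ENNReal.ofReal r) := by
    simpa using hr
  -- Displacements inside the ball have norm at most `4 * r`. With `2 * r`, linear images in one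
  -- class differ by at most `2 ^ q * r / 4`; adding the error `r / 16` and doubling for the
  -- distance gives at most `5 / 8 * (2 ^ q * r)`, as `2 ^ q ≥ 1`.
  obtain ⟨κ, T, hT, hκT, hκ⟩ := hcl (2 * r) (by positivity)
  obtain ⟨R, hRT, hRS, hR⟩ := exists_finset_representatives (Metric.eball c (ENNReal.ofReal r))
    (fun y ↦ κ (toTangent d x (e y - e c))) T (fun y hy ↦ hκT _ (by
      have := dist_le c (hcU hcc) y (hcU hy) r hr (edist_lt_of_mem_eball le_rfl hcc hy)
      rw [tangentNorm_eq_norm_toTangent] at this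
      linarith))
  refine ⟨R.image F, ?_, fun y hy ↦ ?_⟩
  · calc ((R.image F).card : ℝ) ≤ T.card := by exact_mod_cast Finset.card_image_le.trans hRT
      _ ≤ _ := hT.trans_eq (by ring)
  · obtain ⟨z, hzR, hyz⟩ := hR y hy
    refine ⟨F z, Finset.mem_image_of_mem F hzR, ?_⟩
    have hz := hRS hzR
    have h1 := hκ _ _ hyz
    rw [← map_sub, ← map_sub] at h1
    have h4 := dist_le z (hcU hz) y (hcU hy) r hr (edist_lt_of_mem_eball le_rfl hz hy)
    obtain ⟨-, h2, h3⟩ := hUall z (hcU hz) y (hcU hy)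
    dsimp only at h2
    have h5 : ‖A (toTangent d x (e y - e z))‖ ≤ 2 ^ q * (2 * r) / 8 := by
      rwa [show e y - e c - (e z - e c) = e y - e z by abel] at h1
    have h6 : tangentNorm (F x) (e' (F y) - e' (F z)) ≤ 5 / 16 * (2 ^ q * r) := by
      rw [tangentNorm_eq_norm_toTangent]
      have hq1 : (1 : ℝ) ≤ 2 ^ q := one_le_pow₀ one_le_two
      calc _ ≤ _ := norm_le_norm_sub_add _ (A (toTangent d x (e y - e z)))
        _ ≤ 1 / 64 * (4 * r) + 2 ^ q * (2 * r) / 8 := add_le_add (h2.trans (by gcongr)) h5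
        _ ≤ _ := by nlinarith
    rw [Metric.mem_eball, edist_comm]
    refine h3.trans_lt ?_
    rw [ENNReal.ofReal_lt_ofReal_iff (by positivity)]
    have : 0 < (2 : ℝ) ^ q * r := by positivity
    calc _ ≤ 2 * (5 / 16 * (2 ^ q * r)) := by gcongr; exact h6
      _ < _ := by linarith

lemma exists_hasBallExpansion [CompactSpace M] {F : M → M} (hF : ContMDiff (𝓡 d) (𝓡 d) 1 F)
    {k : ℕ} (hk : 1 ≤ k) {Λ : ℝ} (hΛ : 1 ≤ Λ)
    (hA : ∀ (x : M) (S : Submodule ℝ (TangentSpace (𝓡 d) x)),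
      1 ≤ finrank ℝ S → finrank ℝ S ≤ k →
      jacobianOn (mfderiv (𝓡 d) (𝓡 d) F x :
        TangentSpace (𝓡 d) x →ₗ[ℝ] TangentSpace (𝓡 d) (F x)) S ≤ Λ) :
    ∃ (q : M → ℕ) (r₀ : ℝ), 0 < r₀ ∧ (∀ x, (2 : ℝ) ^ q x ≤ 2 * Λ) ∧
      HasBallExpansion F q k ((34 * d) ^ d * 2 ^ k * Λ) r₀ := by
  choose U hU p hp hUp using fun x ↦ exists_local_ball_expansion (hF x) hk hΛ (hA x)
  obtain ⟨ε, hε, hεU⟩ : ∃ ε > 0, ∀ x : M, ∃ y, Metric.eball x ε ⊆ U y := by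
    have := lebesgue_number_lemma_of_emetric_nhds (isCompact_univ (X := M)) (c := U)
      (fun x _ ↦ hU x)
    simpa using this
  obtain ⟨r₀, hr₀, hr₀ε⟩ : ∃ r₀ : ℝ, 0 < r₀ ∧ 2 * ENNReal.ofReal r₀ ≤ ε := by
    rcases eq_or_ne ε ⊤ with rfl | h
    · exact ⟨1, one_pos, le_top⟩
    · refine ⟨ε.toReal / 2, half_pos (ENNReal.toReal_pos hε.ne' h), ?_⟩
      rw [show (2 : ℝ≥0∞) = ENNReal.ofReal 2 by simp, ← ENNReal.ofReal_mul zero_le_two,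
        mul_div_cancel₀ _ two_ne_zero]
      exact (ENNReal.ofReal_toReal h).le
  choose i hi using hεU
  -- The symbol is not constant on a ball, but one point with symbol `m` suffices: the whole ball
  -- lies in its neighbourhood `U`, so the expansion at scale `2 ^ m` applies to all of it.
  refine ⟨fun x ↦ p (i x), r₀, hr₀, fun x ↦ hp _, fun c m r hr hr' ↦ ?_⟩
  by_cases h : ∃ x ∈ Metric.eball c (ENNReal.ofReal r), p (i x) = m
  · obtain ⟨x, hx, rfl⟩ := h
    obtain ⟨T, hT, hT'⟩ := hUp (i x) c r hr (fun y hy ↦ hi x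
      ((edist_lt_of_mem_eball hr' hy hx).trans_le hr₀ε))
    exact ⟨T, hT, fun y hy _ ↦ hT' y hy⟩
  · push Not at h
    exact ⟨∅, by simp; positivity, fun x hx hxm ↦ absurd hxm (h x hx)⟩

end BallExpansion

/-! ### From local to global Lipschitz bounds, and covers of Lipschitz cubes -/

section Lipschitz

/-- A map on `[0, 1]` that is Lipschitz at every point, with a uniform constant, is Lipschitz. -/
lemma edist_le_of_forall_eventually {X : Type*} [PseudoEMetricSpace X] {h : ℝ → X} {L : ℝ}
    (hL : 0 ≤ L)
    (hh : ∀ u ∈ Icc (0 : ℝ) 1, ∀ᶠ v in 𝓝 u, edist (h v) (h u) ≤ ENNReal.ofReal (L * |v - u|)) :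
    edist (h 1) (h 0) ≤ ENNReal.ofReal L := by
  have hcont : ContinuousOn h (Icc 0 1) := by
    intro u hu
    apply ContinuousAt.continuousWithinAt
    rw [ContinuousAt, tendsto_iff_edist_tendsto_0]
    have hlim : Tendsto (fun v ↦ ENNReal.ofReal (L * |v - u|)) (𝓝 u) (𝓝 0) := by
      have : ContinuousAt (fun v ↦ ENNReal.ofReal (L * |v - u|)) u := by
        apply ENNReal.continuous_ofReal.continuousAt.comp
        fun_prop
      simpa [ContinuousAt] using this
    exact tendsto_of_tendsto_of_tendsto_of_le_of_le' tendsto_const_nhds hlim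
      (Eventually.of_forall fun _ ↦ zero_le) (hh u hu)
  let s : Set ℝ := {u | edist (h u) (h 0) ≤ ENNReal.ofReal (L * u)}
  have hs : IsClosed (s ∩ Icc 0 1) := by
    have := isClosed_Icc.isClosed_le
      ((continuous_edist.comp_continuousOn (hcont.prodMk (continuousOn_const (c := h 0)))))
      (g := fun u ↦ ENNReal.ofReal (L * u)) (f := fun u ↦ edist (h u) (h 0))
      (ENNReal.continuous_ofReal.comp (by fun_prop)).continuousOn
    convert this using 1
    ext u
    exact and_comm
  have key : Icc (0 : ℝ) 1 ⊆ s := by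
    refine hs.Icc_subset_of_forall_exists_gt (by simp [s]) ?_
    rintro u ⟨hus, hu⟩ v hv
    have h1 : ∀ᶠ w in 𝓝[>] u, edist (h w) (h u) ≤ ENNReal.ofReal (L * |w - u|) :=
      nhdsWithin_le_nhds (hh u (Ico_subset_Icc_self hu))
    obtain ⟨w, hw, hwv⟩ := (h1.and (Ioc_mem_nhdsGT hv)).exists
    refine ⟨w, ?_, hwv⟩
    calc edist (h w) (h 0) ≤ edist (h w) (h u) + edist (h u) (h 0) := edist_triangle _ _ _
      _ ≤ ENNReal.ofReal (L * |w - u|) + ENNReal.ofReal (L * u) := add_le_add hw hus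
      _ = ENNReal.ofReal (L * w) := by
        rw [abs_of_pos (sub_pos.2 hwv.1), ← ENNReal.ofReal_add
          (mul_nonneg hL (sub_nonneg.2 hwv.1.le)) (mul_nonneg hL hu.1)]
        congr 1; ring
  simpa [s] using key (right_mem_Icc.2 zero_le_one)

lemma edist_le_of_convex {X E : Type*} [PseudoEMetricSpace X] [NormedAddCommGroup E]
    [NormedSpace ℝ E] {φ : E → X} {Q : Set E} (hQ : Convex ℝ Q) {L : ℝ} (hL : 0 ≤ L)
    (hφ : ∀ t ∈ Q, ∀ᶠ t' in 𝓝 t, edist (φ t') (φ t) ≤ ENNReal.ofReal (L * ‖t' - t‖))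
    {s t : E} (hs : s ∈ Q) (ht : t ∈ Q) : edist (φ t) (φ s) ≤ ENNReal.ofReal (L * ‖t - s‖) := by
  have := edist_le_of_forall_eventually (h := fun u : ℝ ↦ φ (s + u • (t - s)))
    (L := L * ‖t - s‖) (by positivity) (fun u hu ↦ ?_)
  · simpa using this
  have hc : ContinuousAt (fun u : ℝ ↦ s + u • (t - s)) u := by fun_prop
  filter_upwards [hc.eventually (hφ _ (hQ.add_smul_sub_mem hs ht hu))] with v hv
  refine hv.trans_eq ?_
  rw [add_sub_add_left_eq_sub, ← sub_smul, norm_smul, Real.norm_eq_abs]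
  congr 1; ring

/-- A grid of mesh `ρ / (2 * L)` has image pieces of diameter at most `ρ / 2`. Each coordinate uses
at most `4 * L / ρ + 2` values, and `ρ ≤ 1` absorbs the `2`. -/
lemma exists_cover_image_cube {X : Type*} [PseudoEMetricSpace X] {k : ℕ} {φ : (Fin k → ℝ) → X}
    {L : ℝ} (hL : 0 < L) (hφ : ∀ s ∈ cube k, ∀ t ∈ cube k,
      edist (φ t) (φ s) ≤ ENNReal.ofReal (L * ‖t - s‖)) {ρ : ℝ} (hρ : 0 < ρ) (hρ1 : ρ ≤ 1) :
    ∃ T : Finset X, (T.card : ℝ) ≤ (4 * L + 2) ^ k / ρ ^ k ∧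
      φ '' cube k ⊆ ⋃ z ∈ T, Metric.eball z (ENNReal.ofReal ρ) := by
  classical
  have hcoord : ∀ t ∈ cube k, ∀ c, -1 ≤ t c ∧ t c ≤ 1 := fun t ht c ↦ ⟨ht.1 c, ht.2 c⟩
  obtain ⟨R, hRT, hRS, hR⟩ := exists_finset_representatives (cube k)
    (fun t c ↦ ⌊t c * (2 * L / ρ)⌋)
    (Fintype.piFinset fun _ : Fin k ↦ Finset.Icc ⌊-(2 * L / ρ)⌋ ⌊2 * L / ρ⌋) (by
      intro t ht
      rw [Fintype.mem_piFinset]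
      intro c
      obtain ⟨h1, h2⟩ := hcoord t ht c
      have h0 : 0 < 2 * L / ρ := by positivity
      exact Finset.mem_Icc.2 ⟨Int.floor_le_floor (by nlinarith), Int.floor_le_floor (by nlinarith)⟩)
  refine ⟨R.image φ, ?_, ?_⟩
  · calc ((R.image φ).card : ℝ) ≤ (Fintype.piFinset fun _ : Fin k ↦
          Finset.Icc ⌊-(2 * L / ρ)⌋ ⌊2 * L / ρ⌋).card := by
          exact_mod_cast Finset.card_image_le.trans hRT
      _ = ((⌊2 * L / ρ⌋ + 1 - ⌊-(2 * L / ρ)⌋).toNat : ℝ) ^ k := by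
          rw [Fintype.card_piFinset, Finset.prod_const, Int.card_Icc, Finset.card_univ,
            Fintype.card_fin, Nat.cast_pow]
      _ ≤ ((4 * L + 2) / ρ) ^ k := by
          gcongr
          have h1 : ((⌊2 * L / ρ⌋ + 1 - ⌊-(2 * L / ρ)⌋ : ℤ) : ℝ) ≤ (4 * L + 2) / ρ := by
            push_cast
            have := Int.floor_le (2 * L / ρ)
            have := Int.lt_floor_add_one (-(2 * L / ρ))
            have h2 : 2 ≤ 2 / ρ := by rw [le_div_iff₀ hρ]; linarith
            have h3 : (4 * L + 2) / ρ = 2 * L / ρ + 2 * L / ρ + 2 / ρ := by ring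
            linarith
          have h2 : (0 : ℤ) ≤ ⌊2 * L / ρ⌋ + 1 - ⌊-(2 * L / ρ)⌋ := by
            have h0 : 0 < 2 * L / ρ := by positivity
            have : ⌊-(2 * L / ρ)⌋ ≤ ⌊2 * L / ρ⌋ := Int.floor_le_floor (by linarith)
            omega
          rw [← Int.toNat_of_nonneg h2] at h1
          exact_mod_cast h1
      _ = _ := div_pow _ _ _
  · rintro _ ⟨t, ht, rfl⟩
    obtain ⟨s, hsR, hs⟩ := hR t ht
    refine mem_iUnion₂.2 ⟨φ s, Finset.mem_image_of_mem φ hsR, ?_⟩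
    rw [Metric.mem_eball]
    refine (hφ s (hRS hsR) t ht).trans_lt ?_
    rw [ENNReal.ofReal_lt_ofReal_iff hρ]
    have hn : ‖t - s‖ ≤ ρ / (2 * L) := by
      rw [pi_norm_le_iff_of_nonneg (by positivity)]
      intro c
      have := Int.abs_sub_lt_one_of_floor_eq_floor (congrFun hs c)
      rw [← sub_mul, abs_mul, abs_of_pos (show 0 < 2 * L / ρ by positivity)] at this
      rw [Pi.sub_apply, Real.norm_eq_abs, le_div_iff₀ (by positivity)]
      have h2 : |t c - s c| * (2 * L / ρ) * ρ ≤ 1 * ρ := by gcongr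
      calc _ = |t c - s c| * (2 * L / ρ) * ρ := by field_simp
        _ ≤ _ := by linarith
    calc L * ‖t - s‖ ≤ L * (ρ / (2 * L)) := by gcongr
      _ = ρ / 2 := by field_simp
      _ < ρ := by linarith

end Lipschitz

/-! ### Disks of size at most one are uniformly Lipschitz -/

section DiskLipschitz

variable {d : ℕ} {M : Type*} [EMetricSpace M] [ChartedSpace (EuclideanSpace ℝ (Fin d)) M]
  [IsManifold (𝓡 d) ∞ M] [RiemannianBundle (fun x : M ↦ TangentSpace (𝓡 d) x)]
  [IsContinuousRiemannianBundle (EuclideanSpace ℝ (Fin d))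
      (fun x : M ↦ TangentSpace (𝓡 d) x)] [IsRiemannianManifold (𝓡 d) M]

lemma tangentNorm_le_opNorm (x : M) (v : EuclideanSpace ℝ (Fin d)) :
    tangentNorm x v ≤ ‖toTangent d x‖ * ‖v‖ := (toTangent d x).le_opNorm v

/-- The inverse of a smooth chart is locally Lipschitz for the Riemannian distance. -/
lemma exists_eventually_edist_le_chart {χ : OpenPartialHomeomorph M (EuclideanSpace ℝ (Fin d))}
    (hχ : χ ∈ IsManifold.maximalAtlas (𝓡 d) ∞ M) {x : M} (hx : x ∈ χ.source) :
    ∃ C : ℝ, 0 ≤ C ∧ ∀ᶠ p in 𝓝 x ×ˢ 𝓝 x,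
      edist p.1 p.2 ≤ ENNReal.ofReal (C * ‖χ p.2 - χ p.1‖) := by
  set e := extChartAt (𝓡 d) x with he
  have h1 : ContMDiffAt (𝓡 d) 𝓘(ℝ, EuclideanSpace ℝ (Fin d)) ∞ (e ∘ χ.symm) (χ x) := by
    have h2 : ContMDiffAt (𝓡 d) (𝓡 d) ∞ χ.symm (χ x) :=
      contMDiffAt_symm_of_mem_maximalAtlas hχ (χ.map_source hx)
    have h3 : ContMDiffAt (𝓡 d) 𝓘(ℝ, EuclideanSpace ℝ (Fin d)) ∞ e (χ.symm (χ x)) := by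
      rw [χ.left_inv hx]
      exact contMDiffAt_extChartAt
    exact h3.comp _ h2
  have h2 : ContDiffAt ℝ 1 (e ∘ χ.symm) (χ x) :=
    (contMDiffAt_iff_contDiffAt.1 h1).of_le (by exact_mod_cast le_top)
  obtain ⟨K, t, ht, hKt⟩ := h2.exists_lipschitzOnWith
  refine ⟨2 * (‖toTangent d x‖ * K), by positivity, ?_⟩
  have A : ∀ᶠ y in 𝓝 x, y ∈ χ.source ∧ χ y ∈ t :=
    Filter.Eventually.and (χ.open_source.mem_nhds hx) ((χ.continuousAt hx).eventually ht)
  filter_upwards [eventually_edist_le_tangentNorm (d := d) x one_lt_two, A.prod_mk A]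
    with ⟨p, q⟩ hpq ⟨⟨hp, hpt⟩, ⟨hq, hqt⟩⟩
  dsimp only at hpq hp hpt hq hqt ⊢
  refine hpq.trans (ENNReal.ofReal_le_ofReal ?_)
  have h4 : ‖e q - e p‖ ≤ K * ‖χ q - χ p‖ := by
    have := hKt.dist_le_mul _ hqt _ hpt
    simpa [dist_eq_norm, χ.left_inv hp, χ.left_inv hq] using this
  calc 2 * tangentNorm x (e q - e p) ≤ 2 * (‖toTangent d x‖ * (K * ‖χ q - χ p‖)) := by
        gcongr
        exact (tangentNorm_le_opNorm x _).trans (by gcongr)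
    _ = _ := by ring

/-- The uniform constants of local Lipschitz continuity of the inverses of the charts of a finite
atlas. -/
lemma FiniteAtlas.exists_uniform_lipschitz [CompactSpace M] (𝒜 : FiniteAtlas d M) :
    ∃ C : ℝ, 0 ≤ C ∧ ∀ i, ∀ x ∈ 𝒜.dom i, ∀ᶠ y in 𝓝 x,
      edist y x ≤ ENNReal.ofReal (C * ‖𝒜.chart i y - 𝒜.chart i x‖) := by
  have h : ∀ i, ∃ C : ℝ, 0 ≤ C ∧ ∀ x ∈ closure (𝒜.dom i), ∀ᶠ y in 𝓝 x,
      edist y x ≤ ENNReal.ofReal (C * ‖𝒜.chart i y - 𝒜.chart i x‖) := by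
    intro i
    -- Here it matters that the chart is defined on the compact closure of `dom i`: local constants
    -- at its points combine into one.
    refine isClosed_closure.isCompact.induction_on (p := fun s ↦ ∃ C : ℝ, 0 ≤ C ∧
      ∀ x ∈ s, ∀ᶠ y in 𝓝 x, edist y x ≤ ENNReal.ofReal (C * ‖𝒜.chart i y - 𝒜.chart i x‖))
      ⟨0, le_rfl, by simp⟩ ?_ ?_ ?_
    · rintro s t hst ⟨C, hC, h⟩
      exact ⟨C, hC, fun x hx ↦ h x (hst hx)⟩
    · rintro s t ⟨C, hC, h⟩ ⟨C', hC', h'⟩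
      refine ⟨max C C', le_max_of_le_left hC, fun x hx ↦ ?_⟩
      rcases hx with hx | hx
      · filter_upwards [h x hx] with y hy
        exact hy.trans (ENNReal.ofReal_le_ofReal (by gcongr; exact le_max_left _ _))
      · filter_upwards [h' x hx] with y hy
        exact hy.trans (ENNReal.ofReal_le_ofReal (by gcongr; exact le_max_right _ _))
    · intro x hx
      obtain ⟨C, hC, h⟩ := exists_eventually_edist_le_chart (𝒜.chart_mem i)
        (𝒜.closure_dom_subset i hx)
      obtain ⟨U, hU, hUU⟩ := eventually_prod_self_iff'.1 h
      refine ⟨interior U, mem_nhdsWithin_of_mem_nhds (interior_mem_nhds.2 hU), C, hC,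
        fun y hy ↦ ?_⟩
      filter_upwards [isOpen_interior.mem_nhds hy] with z hz
      have := hUU y (interior_subset hy) z (interior_subset hz)
      rwa [edist_comm] at this
  choose C hC hC' using h
  refine ⟨∑ i, C i, Finset.sum_nonneg fun i _ ↦ hC i, fun i x hx ↦ ?_⟩
  filter_upwards [hC' i x (subset_closure hx)] with y hy
  refine hy.trans (ENNReal.ofReal_le_ofReal ?_)
  gcongr
  exact Finset.single_le_sum (fun i _ ↦ hC i) (Finset.mem_univ i)

lemma norm_fderiv_le_of_partialDeriv_le {k : ℕ} {g : (Fin k → ℝ) → EuclideanSpace ℝ (Fin d)}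
    {t : Fin k → ℝ} (hg : DifferentiableAt ℝ g t) {B : ℝ}
    (h : ∀ (c : Fin 1 → Fin k) (j : Fin d), |partialDeriv g c j t| ≤ B) (v : Fin k → ℝ) :
    ‖fderiv ℝ g t v‖ ≤ k * d * B * ‖v‖ := by
  have hcol : ∀ c, ‖fderiv ℝ g t (Pi.single c 1)‖ ≤ d * B := by
    intro c
    have hj : ∀ j, |fderiv ℝ g t (Pi.single c 1) j| ≤ B := by
      intro j
      have h1 := h (fun _ ↦ c) j
      rw [partialDeriv, iteratedFDeriv_one_apply] at h1
      have h2 : HasFDerivAt (fun u ↦ g u j)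
          ((EuclideanSpace.proj j : EuclideanSpace ℝ (Fin d) →L[ℝ] ℝ) ∘L fderiv ℝ g t) t :=
        (EuclideanSpace.proj j : EuclideanSpace ℝ (Fin d) →L[ℝ] ℝ).hasFDerivAt.comp t
          hg.hasFDerivAt
      rw [h2.fderiv] at h1
      exact h1
    rw [← (EuclideanSpace.basisFun (Fin d) ℝ).sum_repr (fderiv ℝ g t (Pi.single c 1))]
    refine (norm_sum_le _ _).trans ?_
    calc _ ≤ ∑ _j : Fin d, B := by
          refine Finset.sum_le_sum fun j _ ↦ ?_
          rw [norm_smul, (EuclideanSpace.basisFun (Fin d) ℝ).orthonormal.1 j, mul_one]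
          simpa using hj j
      _ = _ := by simp
  have hv : v = ∑ c, v c • (Pi.single c (1 : ℝ) : Fin k → ℝ) := by
    simpa using (pi_eq_sum_univ' v)
  conv_lhs => rw [hv, map_sum]
  refine (norm_sum_le _ _).trans ?_
  calc _ ≤ ∑ _c : Fin k, ‖v‖ * (d * B) := by
        refine Finset.sum_le_sum fun c _ ↦ ?_
        rw [map_smul, norm_smul]
        gcongr
        · exact norm_le_pi_norm v c
        · exact hcol c
    _ = _ := by simp; ring

lemma IsSingularDisk.eventually_edist_le [CompactSpace M] {𝒜 : FiniteAtlas d M} {C : ℝ}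
    (hC0 : 0 ≤ C) (hC : ∀ i, ∀ x ∈ 𝒜.dom i, ∀ᶠ y in 𝓝 x,
      edist y x ≤ ENNReal.ofReal (C * ‖𝒜.chart i y - 𝒜.chart i x‖))
    {k : ℕ} {φ : (Fin k → ℝ) → M} (hφ : IsSingularDisk (d := d) ⊤ φ) (hsize : size 𝒜 ⊤ φ ≤ 1)
    {t : Fin k → ℝ} (ht : t ∈ cube k) :
    ∀ᶠ t' in 𝓝 t, edist (φ t') (φ t) ≤ ENNReal.ofReal (C * (k * d * 2 + 1) * ‖t' - t‖) := by
  obtain ⟨U, hU, hQU, hφU⟩ := hφ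
  have hφt : ContMDiffAt 𝓘(ℝ, Fin k → ℝ) (𝓡 d) ∞ φ t :=
    hφU.contMDiffAt (hU.mem_nhds (hQU ht))
  -- Relaxing `≤ 1` to `< 2` selects a chart at `t` without showing that the infimum is attained.
  have hlt : (⨅ (i : Fin 𝒜.card) (_ : φ t ∈ 𝒜.dom i),
      ⨆ (m : ℕ) (_ : 1 ≤ m ∧ (m : ℕ∞) ≤ ⊤) (c : Fin m → Fin k) (j : Fin d),
        ENNReal.ofReal |partialDeriv (𝒜.chart i ∘ φ) c j t|) < 2 :=
    lt_of_le_of_lt ((le_iSup₂ (f := fun t (_ : t ∈ cube k) ↦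
      ⨅ (i : Fin 𝒜.card) (_ : φ t ∈ 𝒜.dom i),
      ⨆ (m : ℕ) (_ : 1 ≤ m ∧ (m : ℕ∞) ≤ ⊤) (c : Fin m → Fin k) (j : Fin d),
        ENNReal.ofReal |partialDeriv (𝒜.chart i ∘ φ) c j t|) t ht).trans hsize) (by norm_num)
  simp only [iInf_lt_iff] at hlt
  obtain ⟨i, hi, hlt⟩ := hlt
  set g := 𝒜.chart i ∘ φ with hg
  have hpd : ∀ (c : Fin 1 → Fin k) (j : Fin d), |partialDeriv g c j t| ≤ 2 := by
    intro c j
    have h1 : ENNReal.ofReal |partialDeriv g c j t| ≤ ENNReal.ofReal 2 := by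
      rw [show ENNReal.ofReal 2 = 2 by simp]
      refine le_trans ?_ hlt.le
      refine le_iSup₂_of_le (f := fun (m : ℕ) (_ : 1 ≤ m ∧ (m : ℕ∞) ≤ ⊤) ↦
        ⨆ (c : Fin m → Fin k) (j : Fin d), ENNReal.ofReal |partialDeriv g c j t|)
        1 ⟨le_rfl, le_top⟩ ?_
      exact le_iSup₂ (f := fun (c : Fin 1 → Fin k) (j : Fin d) ↦
        ENNReal.ofReal |partialDeriv g c j t|) c j
    exact (ENNReal.ofReal_le_ofReal_iff zero_le_two).1 h1
  have hsrc : φ t ∈ (𝒜.chart i).source := 𝒜.closure_dom_subset i (subset_closure hi)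
  have hgd : DifferentiableAt ℝ g t := by
    have h1 : ContMDiffAt (𝓡 d) (𝓡 d) ∞ (𝒜.chart i) (φ t) :=
      contMDiffAt_of_mem_maximalAtlas (𝒜.chart_mem i) hsrc
    have h2 : ContMDiffAt 𝓘(ℝ, Fin k → ℝ) 𝓘(ℝ, EuclideanSpace ℝ (Fin d)) ∞ g t := h1.comp t hφt
    exact (contMDiffAt_iff_contDiffAt.1 h2).differentiableAt (by simp)
  have hlo := hgd.hasFDerivAt.isLittleO.def one_pos
  filter_upwards [hlo, hφt.continuousAt.eventually (hC i _ hi)] with t' h1 h2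
  refine h2.trans (ENNReal.ofReal_le_ofReal ?_)
  rw [mul_assoc]
  gcongr
  have h3 := norm_fderiv_le_of_partialDeriv_le hgd hpd (t' - t)
  calc ‖g t' - g t‖ ≤ ‖g t' - g t - fderiv ℝ g t (t' - t)‖ + ‖fderiv ℝ g t (t' - t)‖ :=
        norm_le_norm_sub_add _ _
    _ ≤ 1 * ‖t' - t‖ + k * d * 2 * ‖t' - t‖ := add_le_add h1 h3
    _ = _ := by ring

lemma exists_cover_uniformDisks [CompactSpace M] (𝒜 : FiniteAtlas d M) (k : ℕ) :
    ∃ C : ℝ, 0 ≤ C ∧ ∀ D ∈ uniformDisks 𝒜 ⊤ k, ∀ ρ : ℝ, 0 < ρ → ρ ≤ 1 →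
      ∃ T : Finset M, (T.card : ℝ) ≤ C / ρ ^ k ∧
        D ⊆ ⋃ z ∈ T, Metric.eball z (ENNReal.ofReal ρ) := by
  obtain ⟨C, hC0, hC⟩ := 𝒜.exists_uniform_lipschitz
  set L := C * (k * d * 2 + 1) + 1 with hL
  refine ⟨(4 * L + 2) ^ k, by positivity, ?_⟩
  rintro D ⟨φ, hφ, hsize, rfl⟩ ρ hρ hρ1
  refine exists_cover_image_cube (by positivity) (fun s hs t ht ↦ ?_) hρ hρ1
  refine edist_le_of_convex (convex_Icc _ _) (by positivity) (fun t ht ↦ ?_) hs ht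
  filter_upwards [hφ.eventually_edist_le hC0 hC hsize ht] with t' h
  refine h.trans (ENNReal.ofReal_le_ofReal ?_)
  gcongr
  linarith

end DiskLipschitz

/-! ### Degenerate families: no disk, or disks reduced to points -/

lemma uniformEntropy_empty {X : Type*} [UniformSpace X] (f : X → X) :
    uniformEntropy f ∅ = ⊥ := by
  refine le_bot_iff.1 (iSup₂_le fun U _ ↦ ?_)
  simp only [mem_empty_iff_false, iSup_false, iSup_bot]
  exact expGrowthSup_zero.le

lemma uniformEntropy_nonpos_of_subsingleton {X : Type*} [UniformSpace X] (f : X → X)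
    {𝒟 : Set (Set X)} (h𝒟 : ∀ D ∈ 𝒟, D.Subsingleton) : uniformEntropy f 𝒟 ≤ 0 := by
  refine iSup₂_le fun U hU ↦ ?_
  rw [← expGrowthSup_const (b := 1) one_ne_zero ENNReal.one_ne_top]
  refine expGrowthSup_monotone fun n ↦ iSup₂_le fun D hD ↦ ?_
  rcases (h𝒟 D hD).eq_empty_or_singleton with rfl | ⟨x, rfl⟩
  · simp
  · have hcov : IsDynCoverOf f {x} U n ({x} : Finset X) := by
      rintro y rfl
      refine ⟨y, by simp, ?_⟩
      exact mem_dynEntourage.2 fun j _ ↦ refl_mem_uniformity hU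
    simpa using ENat.toENNReal_mono hcov.coverMincard_le_card

/-! ### Jacobians of iterates and `‖Λ^k Tf‖` -/

section Jacobian

open Module

variable {d : ℕ} {M : Type*} [TopologicalSpace M] [ChartedSpace (EuclideanSpace ℝ (Fin d)) M]
  [IsManifold (𝓡 d) ∞ M] [RiemannianBundle (fun x : M ↦ TangentSpace (𝓡 d) x)]

/-- The derivative of `f` at `x`, as a linear map. -/
abbrev tangentMap₀ (d : ℕ) {M : Type*} [TopologicalSpace M]
    [ChartedSpace (EuclideanSpace ℝ (Fin d)) M] (f : M → M) (x : M) :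
    TangentSpace (𝓡 d) x →ₗ[ℝ] TangentSpace (𝓡 d) (f x) :=
  (mfderiv (𝓡 d) (𝓡 d) f x : TangentSpace (𝓡 d) x →ₗ[ℝ] TangentSpace (𝓡 d) (f x))

lemma ofReal_jacobianOn_le_normLambda {k : ℕ} (f : M → M) (x : M)
    (S : Submodule ℝ (TangentSpace (𝓡 d) x)) (h1 : min 1 k ≤ finrank ℝ S)
    (h2 : finrank ℝ S ≤ k) :
    ENNReal.ofReal (jacobianOn (tangentMap₀ d f x) S) ≤ normLambda d k f :=
  le_iSup₂_of_le (finrank ℝ S) ⟨h1, h2⟩ (le_iSup₂_of_le x S (le_iSup_of_le rfl le_rfl))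

lemma jacobianOn_le_one_of_finrank_eq_zero {V W : Type*} [NormedAddCommGroup V]
    [InnerProductSpace ℝ V] [FiniteDimensional ℝ V] [NormedAddCommGroup W]
    [InnerProductSpace ℝ W] [FiniteDimensional ℝ W] (A : V →ₗ[ℝ] W) {S : Submodule ℝ V}
    (hS : finrank ℝ S = 0) : jacobianOn A S ≤ 1 := by
  have := jacobianOn_le_pow A (c := ‖A.toContinuousLinearMap‖)
    A.toContinuousLinearMap.le_opNorm S
  rwa [hS, pow_zero] at this

/-- Chain rule and multiplicativity of Jacobians. The derivative may lower the dimension of `S`, so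
the bound is assumed in all dimensions up to `k`. -/
lemma jacobianOn_iterate_le {f : M → M} (hf : ContMDiff (𝓡 d) (𝓡 d) 1 f) {k : ℕ} {Λ : ℝ}
    (hΛ : 0 ≤ Λ) (h : ∀ (x : M) (S : Submodule ℝ (TangentSpace (𝓡 d) x)), finrank ℝ S ≤ k →
      jacobianOn (tangentMap₀ d f x) S ≤ Λ) (N : ℕ) (x : M)
    (S : Submodule ℝ (TangentSpace (𝓡 d) x)) (hS : finrank ℝ S ≤ k) :
    jacobianOn (tangentMap₀ d f^[N] x) S ≤ Λ ^ N := by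
  induction N generalizing x with
  | zero =>
    have := jacobianOn_le_pow (tangentMap₀ d (id : M → M) x) (c := 1) (fun v ↦ by
      simp [tangentMap₀, mfderiv_id]) S
    simpa using! this
  | succ N ih =>
    have hcomp : tangentMap₀ d f^[N + 1] x =
        tangentMap₀ d f^[N] (f x) ∘ₗ tangentMap₀ d f x := by
      have := mfderiv_comp x ((hf.iterate N).mdifferentiableAt (one_ne_zero) (x := f x))
        (hf.mdifferentiableAt one_ne_zero (x := x))
      exact congrArg (fun L : TangentSpace (𝓡 d) x →L[ℝ] TangentSpace (𝓡 d) (f^[N] (f x)) ↦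
        (L : TangentSpace (𝓡 d) x →ₗ[ℝ] TangentSpace (𝓡 d) (f^[N] (f x)))) this
    rw [hcomp]
    have := jacobianOn_comp (tangentMap₀ d f^[N] (f x)) (tangentMap₀ d f x) S
    refine (this.trans_le ?_).trans_eq (pow_succ Λ N).symm
    exact mul_le_mul (ih _ _ ((Submodule.finrank_map_le _ _).trans hS)) (h x S hS)
      (jacobianOn_nonneg _ _) (by positivity)

/-- On the line spanned by a unit vector, the Jacobian is the norm of its image; lines are among the
subspaces as soon as `k ≥ 1`. -/
lemma norm_apply_le_of_normLambda {k : ℕ} (hk : 1 ≤ k) {f : M → M}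
    (h : normLambda d k f ≠ ⊤) (x : M) (v : TangentSpace (𝓡 d) x) :
    ‖tangentMap₀ d f x v‖ ≤ (normLambda d k f).toReal * ‖v‖ := by
  classical
  have hunit : ∀ u : TangentSpace (𝓡 d) x, ‖u‖ = 1 →
      ‖tangentMap₀ d f x u‖ ≤ (normLambda d k f).toReal := by
    intro u hu
    have hb : Orthonormal ℝ (fun _ : Unit ↦ u) := by simpa using hu
    have h1 := jacobianOn_span_eq_prod (tangentMap₀ d f x) hb
      (fun i j hij ↦ (hij rfl).elim) Finset.univ
    have h2 := finrank_span_image_orthonormal hb Finset.univ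
    rw [Finset.card_univ, Fintype.card_unit] at h2
    have h3 := ofReal_jacobianOn_le_normLambda f x _
      ((min_le_left 1 k).trans h2.ge) (h2.trans_le hk)
    rw [h1] at h3
    simpa using (ENNReal.ofReal_le_iff_le_toReal h).1 h3
  rcases eq_or_ne v 0 with rfl | hv
  · simp
  · have hv' : ‖v‖ ≠ 0 := norm_ne_zero_iff.2 hv
    have := hunit (‖v‖⁻¹ • v) (by rw [norm_smul, norm_inv, norm_norm, inv_mul_cancel₀ hv'])
    rw [map_smul, norm_smul, norm_inv, norm_norm, inv_mul_le_iff₀ (norm_pos_iff.2 hv)] at this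
    rwa [mul_comm]

lemma normLambda_zero_eq_one [Nonempty M] (f : M → M) : 1 ≤ normLambda d 0 f := by
  obtain ⟨x⟩ := ‹Nonempty M›
  have := ofReal_jacobianOn_le_normLambda (k := 0) f x (⊥ : Submodule ℝ (TangentSpace (𝓡 d) x)) (by simp) (by simp)
  rwa [jacobianOn_eq_normDet, LinearMap.normDet_of_subsingleton, ENNReal.ofReal_one] at this

lemma normLambda_le_pow {k : ℕ} {f : M → M} {L : ℝ≥0∞}
    (hL : ∀ (x : M) (v : TangentSpace (𝓡 d) x), ‖tangentMap₀ d f x v‖ₑ ≤ L * ‖v‖ₑ) :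
    normLambda d k f ≤ max 1 L ^ k := by
  refine iSup₂_le fun ℓ hℓ ↦ iSup₂_le fun x S ↦ iSup_le fun hS ↦ ?_
  change ENNReal.ofReal (jacobianOn (tangentMap₀ d f x) S) ≤ _
  rcases Nat.eq_zero_or_pos ℓ with rfl | hpos
  · refine le_trans ?_ (one_le_pow₀ (le_max_left 1 L))
    rw [← ENNReal.ofReal_one]
    exact ENNReal.ofReal_le_ofReal (jacobianOn_le_one_of_finrank_eq_zero _ hS)
  rcases eq_or_ne L ⊤ with rfl | hLtop
  · have : k ≠ 0 := by omega
    simp [this]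
  have h1 := jacobianOn_le_pow (tangentMap₀ d f x) (c := L.toReal) (fun v ↦ by
    have := hL x v
    rw [← ofReal_norm, ← ofReal_norm, ← ENNReal.ofReal_toReal hLtop,
      ← ENNReal.ofReal_mul ENNReal.toReal_nonneg] at this
    exact (ENNReal.ofReal_le_ofReal_iff (by positivity)).1 this) S
  calc _ ≤ ENNReal.ofReal (L.toReal ^ finrank ℝ S) := ENNReal.ofReal_le_ofReal h1
    _ = L ^ ℓ := by
      rw [ENNReal.ofReal_pow ENNReal.toReal_nonneg, ENNReal.ofReal_toReal hLtop, hS]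
    _ ≤ max 1 L ^ ℓ := by gcongr; exact le_max_right _ _
    _ ≤ max 1 L ^ k := pow_le_pow_right₀ (le_max_left _ _) hℓ.2

end Jacobian

/-! ### Derivative and Lipschitz constant -/

section Lip

variable {d : ℕ} {M : Type*} [EMetricSpace M] [ChartedSpace (EuclideanSpace ℝ (Fin d)) M]
  [IsManifold (𝓡 d) ∞ M] [RiemannianBundle (fun x : M ↦ TangentSpace (𝓡 d) x)]
  [IsContinuousRiemannianBundle (EuclideanSpace ℝ (Fin d))
      (fun x : M ↦ TangentSpace (𝓡 d) x)] [IsRiemannianManifold (𝓡 d) M]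

/-- Follow a straight line in the chart in the direction `v`: at small times distances agree with
norms up to factors `1 + δ`, and `δ` is sent to `0`. -/
lemma norm_mfderiv_le_of_lipschitz {f : M → M} {x : M} (hf : ContMDiffAt (𝓡 d) (𝓡 d) 1 f x)
    {K : ℝ} (hK : 0 ≤ K) (hfK : ∀ y z, edist (f y) (f z) ≤ ENNReal.ofReal K * edist y z)
    (v : TangentSpace (𝓡 d) x) : ‖tangentMap₀ d f x v‖ ≤ K * ‖v‖ := by
  set e := extChartAt (𝓡 d) x with he
  set e' := extChartAt (𝓡 d) (f x) with he'
  have key : ∀ δ : ℝ, 0 < δ → ‖tangentMap₀ d f x v‖ ≤ ((1 + δ) * (K * (1 + δ)) + δ) * ‖v‖ := by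
    intro δ hδ
    have h1 : (1 : ℝ) < 1 + δ := by linarith
    let w : EuclideanSpace ℝ (Fin d) := v
    let γ : ℝ → M := fun s ↦ e.symm (e x + s • w)
    have hline : Tendsto (fun s : ℝ ↦ e x + s • w) (𝓝[>] 0) (𝓝 (e x)) := by
      have : ContinuousAt (fun s : ℝ ↦ e x + s • w) 0 := by fun_prop
      simpa [ContinuousAt] using this.mono_left (nhdsWithin_le_nhds (s := Ioi 0))
    have hγ : Tendsto γ (𝓝[>] 0) (𝓝 x) := by
      have hc : Tendsto e.symm (𝓝 (e x)) (𝓝 x) := by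
        have := continuousAt_extChartAt_symm (I := 𝓡 d) x
        rwa [ContinuousAt, extChartAt_to_inv] at this
      exact hc.comp hline
    have htarget : ∀ᶠ s in 𝓝[>] (0 : ℝ), e x + s • w ∈ e.target := by
      have h0 : ∀ᶠ z in 𝓝 (e x), z ∈ e.target :=
        extChartAt_target_mem_nhds (I := 𝓡 d) x
      exact hline.eventually h0
    have hpair : Tendsto (fun s ↦ (x, γ s)) (𝓝[>] 0) (𝓝 x ×ˢ 𝓝 x) :=
      tendsto_const_nhds.prodMk hγ
    have hpair' : Tendsto (fun s ↦ (f x, f (γ s))) (𝓝[>] 0) (𝓝 (f x) ×ˢ 𝓝 (f x)) :=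
      tendsto_const_nhds.prodMk (hf.continuousAt.tendsto.comp hγ)
    obtain ⟨s, hs, hst, hlin, hup, hlow⟩ := (eventually_mem_nhdsWithin.and (htarget.and
      ((hpair.eventually (eventually_norm_sub_mfderiv_le hf hδ)).and
      ((hpair.eventually (eventually_edist_le_tangentNorm (d := d) x h1)).and
      (hpair'.eventually (eventually_tangentNorm_le_edist (d := d) (f x) h1)))))).exists
    have hs0 : 0 < s := hs
    have hew : e (γ s) - e x = s • w := by
      simp only [γ]
      rw [e.right_inv hst, add_sub_cancel_left]
    dsimp only at hlin hup hlow
    rw [← he, hew] at hlin hup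
    have hsw : tangentNorm x (s • w) = s * ‖v‖ := by
      rw [tangentNorm_eq_norm_toTangent, map_smul, norm_smul, Real.norm_eq_abs, abs_of_pos hs0]
      rfl
    rw [hsw] at hlin hup
    have h2 : tangentNorm (f x) (e' (f (γ s)) - e' (f x)) ≤ (1 + δ) * (K * (1 + δ)) * (s * ‖v‖) := by
      rw [← ENNReal.ofReal_le_ofReal_iff (by positivity)]
      calc _ ≤ ENNReal.ofReal (1 + δ) * edist (f x) (f (γ s)) := hlow
        _ ≤ ENNReal.ofReal (1 + δ) * (ENNReal.ofReal K * ENNReal.ofReal ((1 + δ) * (s * ‖v‖))) := by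
          gcongr
          exact (hfK _ _).trans (by gcongr)
        _ = _ := by
          rw [← ENNReal.ofReal_mul hK, ← ENNReal.ofReal_mul (by positivity)]
          congr 1; ring
    have h3 : ‖tangentMap₀ d f x (toTangent d x (s • w))‖ = s * ‖tangentMap₀ d f x v‖ := by
      rw [map_smul, map_smul, norm_smul, Real.norm_eq_abs, abs_of_pos hs0]
      rfl
    have h4 : s * ‖tangentMap₀ d f x v‖ ≤
        (1 + δ) * (K * (1 + δ)) * (s * ‖v‖) + δ * (s * ‖v‖) := by
      rw [← h3]
      refine (norm_le_norm_add_norm_sub _ _).trans (add_le_add h2 ?_)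
      exact hlin
    have h5 : s * ‖tangentMap₀ d f x v‖ ≤ s * (((1 + δ) * (K * (1 + δ)) + δ) * ‖v‖) := by
      linarith
    exact le_of_mul_le_mul_left h5 hs0
  have hlim : Tendsto (fun δ : ℝ ↦ ((1 + δ) * (K * (1 + δ)) + δ) * ‖v‖) (𝓝[>] 0) (𝓝 (K * ‖v‖)) := by
    have : ContinuousAt (fun δ : ℝ ↦ ((1 + δ) * (K * (1 + δ)) + δ) * ‖v‖) 0 := by fun_prop
    simpa [ContinuousAt] using this.mono_left (nhdsWithin_le_nhds (s := Ioi 0))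
  refine ge_of_tendsto hlim ?_
  filter_upwards [self_mem_nhdsWithin] with δ hδ using key δ hδ

lemma enorm_mfderiv_le_lipConst {f : M → M} {x : M} (hf : ContMDiffAt (𝓡 d) (𝓡 d) 1 f x)
    (v : TangentSpace (𝓡 d) x) : ‖tangentMap₀ d f x v‖ₑ ≤ lipConst f * ‖v‖ₑ := by
  rcases eq_or_ne v 0 with rfl | hv
  · simp
  have hv' : ‖v‖ₑ ≠ 0 := enorm_ne_zero.2 hv
  rw [← ENNReal.div_le_iff hv' enorm_ne_top]
  refine le_sInf fun K hK ↦ ?_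
  rw [ENNReal.div_le_iff hv' enorm_ne_top]
  rcases eq_or_ne K ⊤ with rfl | hKtop
  · rw [ENNReal.top_mul hv']; exact le_top
  have := norm_mfderiv_le_of_lipschitz hf (ENNReal.toReal_nonneg (a := K))
    (by rw [ENNReal.ofReal_toReal hKtop]; exact hK) v
  rw [← ofReal_norm, ← ofReal_norm, ← ENNReal.ofReal_toReal hKtop,
    ← ENNReal.ofReal_mul ENNReal.toReal_nonneg]
  exact ENNReal.ofReal_le_ofReal this

lemma log_max_one_normLambda_le {f : M → M} (hf : ContMDiff (𝓡 d) (𝓡 d) 1 f) (k : ℕ) :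
    ENNReal.log (max 1 (normLambda d k f)) ≤ (k : EReal) * lip f := by
  have h1 : max 1 (normLambda d k f) ≤ max 1 (lipConst f) ^ k :=
    max_le (one_le_pow₀ (le_max_left _ _))
      (normLambda_le_pow fun x v ↦ enorm_mfderiv_le_lipConst (hf x) v)
  refine (ENNReal.log_monotone h1).trans_eq ?_
  rw [ENNReal.log_pow, ENNReal.log_monotone.map_max, ENNReal.log_one, max_comm]
  rfl

end Lip

/-! ### Surjective local contractions -/

/-- A surjective self-map of a compact space which contracts all small distances by a definite
factor lives on a finite space. -/
lemma finite_of_surjective_of_locally_contracting {X : Type*} [EMetricSpace X] [CompactSpace X]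
    {f : X → X} (hf : Function.Surjective f) {c ε : ℝ≥0∞} (hc : c < 1) (hε : 0 < ε)
    (h : ∀ x y, edist x y < ε → edist (f x) (f y) ≤ c * edist x y) : Finite X := by
  classical
  by_contra hfin
  rw [not_finite_iff_infinite] at hfin
  wlog hεtop : ε ≠ ⊤ generalizing ε
  · exact this one_pos (fun x y hxy ↦ h x y (by
      rw [not_not.1 hεtop]; exact hxy.trans ENNReal.one_lt_top)) ENNReal.one_ne_top
  obtain ⟨t, -, ht⟩ := isCompact_univ.elim_nhds_subcover (fun x : X ↦ Metric.eball x ε)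
    (fun x _ ↦ Metric.eball_mem_nhds x hε)
  have hiter : ∀ n x y, edist x y < ε → edist (f^[n] x) (f^[n] y) ≤ c ^ n * ε := by
    intro n x y hxy
    have : edist (f^[n] x) (f^[n] y) ≤ c ^ n * edist x y := by
      induction n generalizing x y with
      | zero => simp
      | succ n ih =>
        have h1 := h x y hxy
        have h2 : edist (f x) (f y) ≤ edist x y :=
          h1.trans (by simpa using mul_le_mul_left hc.le (edist x y))
        calc _ ≤ c ^ n * edist (f x) (f y) := ih (f x) (f y) (h2.trans_lt hxy)
          _ ≤ c ^ n * (c * edist x y) := by gcongr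
          _ = _ := by ring
    exact this.trans (by gcongr)
  -- By surjectivity `X = f^[n] X` is covered by `t.card` images of `ε`-balls, of diameter at most
  -- `2 * c ^ n * ε`. For large `n` they cannot contain these `t.card + 1` separated points.
  obtain ⟨S, hS⟩ := Infinite.exists_subset_card_eq X (t.card + 1)
  obtain ⟨η, hη, hηS⟩ : ∃ η : ℝ≥0∞, 0 < η ∧ ∀ x ∈ S, ∀ y ∈ S, x ≠ y → η ≤ edist x y := by
    have hpos : 0 < (S.offDiag).inf fun p ↦ edist p.1 p.2 := by
      rw [Finset.lt_inf_iff (by simp)]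
      intro p hp
      exact edist_pos.2 (Finset.mem_offDiag.1 hp).2.2
    exact ⟨_, hpos, fun x hx y hy hxy ↦
      Finset.inf_le (f := fun p : X × X ↦ edist p.1 p.2) (b := (x, y))
        (Finset.mem_offDiag.2 ⟨hx, hy, hxy⟩)⟩
  obtain ⟨n, hn⟩ : ∃ n, c ^ n * ε + c ^ n * ε < η := by
    have hlim : Tendsto (fun n ↦ c ^ n * ε + c ^ n * ε) atTop (𝓝 (0 * ε + 0 * ε)) := by
      have h1 := ENNReal.Tendsto.mul_const (ENNReal.tendsto_pow_atTop_nhds_zero_of_lt_one hc)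
        (Or.inr hεtop)
      exact h1.add h1
    simp only [zero_mul, add_zero] at hlim
    exact (hlim.eventually (gt_mem_nhds hη)).exists
  choose g hg using hf.iterate n
  have hcenter : ∀ x : X, ∃ z ∈ t, x ∈ Metric.eball z ε := fun x ↦ by
    simpa using ht (mem_univ x)
  choose z hzt hz using hcenter
  obtain ⟨x, hx, y, hy, hxy, hzz⟩ := Finset.exists_ne_map_eq_of_card_lt_of_maps_to
    (s := S) (t := t) (by omega) (f := fun x ↦ z (g x)) (fun x _ ↦ hzt _)
  have hbound : ∀ x, edist x (f^[n] (z (g x))) ≤ c ^ n * ε := fun x ↦ by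
    have := hiter n (g x) (z (g x)) (hz (g x))
    rwa [hg] at this
  have h1 : edist x y ≤ c ^ n * ε + c ^ n * ε := by
    refine (edist_triangle_right x y (f^[n] (z (g x)))).trans (add_le_add (hbound x) ?_)
    rw [hzz]
    exact hbound y
  exact absurd (hηS x hx y hy hxy) (not_le.2 (h1.trans_lt hn))

/-! ### The entropy bounds -/

section Main

open Module

variable {d : ℕ} {M : Type*} [EMetricSpace M] [CompactSpace M]
  [ChartedSpace (EuclideanSpace ℝ (Fin d)) M]
  [IsManifold (𝓡 d) ∞ M] [RiemannianBundle (fun x : M ↦ TangentSpace (𝓡 d) x)]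
  [IsContinuousRiemannianBundle (EuclideanSpace ℝ (Fin d))
      (fun x : M ↦ TangentSpace (𝓡 d) x)] [IsRiemannianManifold (𝓡 d) M]

lemma infinite_of_dim_pos [Nonempty M] (hd : 0 < d) : Infinite M := by
  by_contra h
  rw [not_infinite_iff_finite] at h
  obtain ⟨x⟩ := ‹Nonempty M›
  have : Nonempty (Fin d) := ⟨⟨0, hd⟩⟩
  have : Nontrivial (EuclideanSpace ℝ (Fin d)) := by
    have : 0 < finrank ℝ (EuclideanSpace ℝ (Fin d)) := by simpa using hd
    exact nontrivial_of_finrank_pos this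
  set e := chartAt (EuclideanSpace ℝ (Fin d)) x
  have : (𝓝[≠] (e x)).NeBot := Module.punctured_nhds_neBot ℝ _ _
  have hinf := infinite_of_mem_nhds (e x) (e.open_target.mem_nhds (mem_chart_target _ x))
  exact hinf (e.image_source_eq_target ▸ (toFinite e.source).image e)

/-- Linearization costs `δ` and each comparison of norm with distance costs `1 + δ`; as `c < 1`, the
total stays below `1` for small `δ`. A Lebesgue number makes the scale uniform. -/
lemma exists_locally_contracting {f : M → M} (hf : ContMDiff (𝓡 d) (𝓡 d) 1 f) {c : ℝ}
    (hc0 : 0 ≤ c) (hc : c < 1)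
    (h : ∀ (x : M) (v : TangentSpace (𝓡 d) x), ‖tangentMap₀ d f x v‖ ≤ c * ‖v‖) :
    ∃ c' ε : ℝ≥0∞, c' < 1 ∧ 0 < ε ∧
      ∀ x y, edist x y < ε → edist (f x) (f y) ≤ c' * edist x y := by
  obtain ⟨δ, hδ, hδc⟩ : ∃ δ : ℝ, 0 < δ ∧ (1 + δ) * ((δ + c) * (1 + δ)) < 1 := by
    have hlim : ContinuousAt (fun δ : ℝ ↦ (1 + δ) * ((δ + c) * (1 + δ))) 0 := by fun_prop
    have h1 := (hlim.tendsto.mono_left (nhdsWithin_le_nhds (s := Ioi 0))).eventually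
      (gt_mem_nhds (show (1 + 0) * ((0 + c) * (1 + 0)) < (1 : ℝ) by linarith))
    obtain ⟨δ, h2, h3⟩ := (eventually_mem_nhdsWithin.and h1).exists
    exact ⟨δ, h2, h3⟩
  have h1δ : (1 : ℝ) < 1 + δ := by linarith
  have hloc : ∀ x : M, ∃ U ∈ 𝓝 x, ∀ y ∈ U, ∀ z ∈ U,
      edist (f y) (f z) ≤ ENNReal.ofReal ((1 + δ) * ((δ + c) * (1 + δ))) * edist y z := by
    intro x
    have hcont := hf.continuous.continuousAt (x := x)
    have hpair : Tendsto (fun p : M × M ↦ (f p.1, f p.2)) (𝓝 x ×ˢ 𝓝 x) (𝓝 (f x) ×ˢ 𝓝 (f x)) :=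
      hcont.tendsto.prodMap hcont.tendsto
    have hall := (eventually_norm_sub_mfderiv_le (hf x) hδ).and
      ((hpair.eventually (eventually_edist_le_tangentNorm (d := d) (f x) h1δ)).and
      (eventually_tangentNorm_le_edist (d := d) x h1δ))
    obtain ⟨U, hU, hUU⟩ := eventually_prod_self_iff'.1 hall
    refine ⟨U, hU, fun y hy z hz ↦ ?_⟩
    obtain ⟨hlin, hup, hlow⟩ := hUU y hy z hz
    dsimp only at hlin hup hlow
    set e := extChartAt (𝓡 d) x with he
    set e' := extChartAt (𝓡 d) (f x) with he'
    have h2 : tangentNorm (f x) (e' (f z) - e' (f y)) ≤ (δ + c) * tangentNorm x (e z - e y) := by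
      rw [tangentNorm_eq_norm_toTangent, add_mul]
      exact (norm_le_norm_sub_add _ _).trans (add_le_add hlin (h x _))
    calc edist (f y) (f z) ≤ _ := hup
      _ ≤ ENNReal.ofReal ((1 + δ) * ((δ + c) * tangentNorm x (e z - e y))) :=
        ENNReal.ofReal_le_ofReal (by gcongr)
      _ = ENNReal.ofReal (1 + δ) * (ENNReal.ofReal (δ + c) *
            ENNReal.ofReal (tangentNorm x (e z - e y))) := by
        rw [ENNReal.ofReal_mul (by positivity), ENNReal.ofReal_mul (by positivity)]
      _ ≤ ENNReal.ofReal (1 + δ) * (ENNReal.ofReal (δ + c) *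
            (ENNReal.ofReal (1 + δ) * edist y z)) := by gcongr
      _ = _ := by
        rw [ENNReal.ofReal_mul (by positivity), ENNReal.ofReal_mul (by positivity)]
        ring
  choose U hU hUU using hloc
  obtain ⟨ε, hε, hεU⟩ := lebesgue_number_lemma_of_emetric_nhds (isCompact_univ (X := M)) (c := U)
    (fun x _ ↦ hU x)
  refine ⟨ENNReal.ofReal ((1 + δ) * ((δ + c) * (1 + δ))), ε, ?_, hε, fun x y hxy ↦ ?_⟩
  · rwa [ENNReal.ofReal_lt_one]
  · obtain ⟨i, hi⟩ := hεU x (mem_univ x)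
    exact hUU i x (hi (Metric.mem_eball_self hε)) y (hi (by rwa [Metric.mem_eball, edist_comm]))

lemma one_le_normLambda_of_surjective [Nonempty M] {f : M → M}
    (hf : ContMDiff (𝓡 d) (𝓡 d) 1 f) (hsurj : Function.Surjective f) {k : ℕ} (hk : k ≤ d) :
    1 ≤ normLambda d k f := by
  rcases Nat.eq_zero_or_pos k with rfl | hpos
  · exact normLambda_zero_eq_one f
  by_contra! hlt
  have hc : (normLambda d k f).toReal < 1 := by
    simpa using (ENNReal.toReal_lt_toReal hlt.ne_top ENNReal.one_ne_top).2 hlt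
  obtain ⟨c', ε, hc', hε, h⟩ := exists_locally_contracting hf ENNReal.toReal_nonneg hc
    (norm_apply_le_of_normLambda hpos hlt.ne_top)
  have := finite_of_surjective_of_locally_contracting hsurj hc' hε h
  have := infinite_of_dim_pos (d := d) (M := M) (by omega)
  exact not_finite M

lemma uniformDimEntropy_le_log_max (𝒜 : FiniteAtlas d M) {f : M → M}
    (hf : ContMDiff (𝓡 d) (𝓡 d) 1 f) (k : ℕ) :
    uniformDimEntropy 𝒜 k f ≤ ENNReal.log (max 1 (normLambda d k f)) := by
  rcases Nat.eq_zero_or_pos k with rfl | hk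
  · calc uniformDimEntropy 𝒜 0 f ≤ 0 := by
          refine uniformEntropy_nonpos_of_subsingleton f ?_
          rintro D ⟨φ, -, -, rfl⟩
          exact (subsingleton_of_subsingleton).image φ
      _ ≤ _ := ENNReal.zero_le_log_iff.2 (le_max_left _ _)
  rcases eq_or_ne (normLambda d k f) ⊤ with htop | htop
  · simp [htop]
  set Λ := max 1 (normLambda d k f).toReal with hΛdef
  have hΛ1 : 1 ≤ Λ := le_max_left _ _
  have hΛ0 : 0 ≤ Λ := zero_le_one.trans hΛ1
  have hΛ : ENNReal.ofReal Λ = max 1 (normLambda d k f) := by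
    rw [hΛdef, ENNReal.ofReal_max, ENNReal.ofReal_one, ENNReal.ofReal_toReal htop]
  have hjac : ∀ (x : M) (S : Submodule ℝ (TangentSpace (𝓡 d) x)), finrank ℝ S ≤ k →
      jacobianOn (tangentMap₀ d f x) S ≤ Λ := by
    intro x S hS
    rcases Nat.eq_zero_or_pos (finrank ℝ S) with h0 | h0
    · exact (jacobianOn_le_one_of_finrank_eq_zero _ h0).trans hΛ1
    · have := ofReal_jacobianOn_le_normLambda f x S ((min_le_left _ _).trans h0) hS
      exact ((ENNReal.ofReal_le_iff_le_toReal htop).1 this).trans (le_max_right _ _)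
  -- For `f^[N]` the exponents satisfy `2 ^ q ≤ 2 * Λ ^ N ≤ 2 ^ (a * N + 1)`: the alphabet has `a *
  -- N + 2` symbols, negligible after the `N`-th root.
  obtain ⟨a, ha0, ha⟩ : ∃ a : ℕ, 0 < a ∧ Λ ≤ 2 ^ a := by
    obtain ⟨a, ha⟩ := pow_unbounded_of_one_lt Λ (one_lt_two (α := ℝ))
    exact ⟨a + 1, a.succ_pos, ha.le.trans (pow_le_pow_right₀ one_le_two a.le_succ)⟩
  obtain ⟨C, hC0, hC⟩ := exists_cover_uniformDisks 𝒜 k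
  set G : ℝ := (34 * d) ^ d * 2 ^ k with hG
  have hG1 : 1 ≤ G := by
    refine one_le_mul_of_one_le_of_one_le ?_ (one_le_pow₀ one_le_two)
    rcases Nat.eq_zero_or_pos d with h0 | h0
    · subst h0; simp
    · apply one_le_pow₀
      have : (1 : ℝ) ≤ d := by exact_mod_cast h0
      linarith
  have hbound : ∀ N : ℕ, 1 ≤ N → uniformDimEntropy 𝒜 k f ≤
      ENNReal.log (ENNReal.ofReal (((a * N + 2) * (G * Λ ^ N)) ^ (1 / N : ℝ))) := by
    intro N hN
    have hΛN : 1 ≤ Λ ^ N := one_le_pow₀ hΛ1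
    obtain ⟨q, r₀, hr₀, hq, hexp⟩ := exists_hasBallExpansion (hf.iterate N) hk hΛN
      (fun x S _ hS ↦ jacobianOn_iterate_le hf hΛ0 hjac N x S hS)
    have hqK : ∀ x, q x < a * N + 2 := by
      intro x
      have h1 : (2 : ℝ) ^ q x ≤ 2 ^ (a * N + 1) := by
        refine (hq x).trans ?_
        rw [pow_succ, pow_mul, mul_comm]
        gcongr
      have := (pow_le_pow_iff_right₀ (one_lt_two (α := ℝ))).1 h1
      omega
    have := uniformEntropy_le_of_hasBallExpansion hf.continuous hN hr₀
      (one_le_mul_of_one_le_of_one_le hG1 hΛN) (by omega) hC0 hexp hqK hC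
    refine this.trans_eq ?_
    push_cast
    rfl
  have hlim : Tendsto (fun N : ℕ ↦ ENNReal.log
      (ENNReal.ofReal (((a * N + 2) * (G * Λ ^ N)) ^ (1 / N : ℝ)))) atTop
      (𝓝 (ENNReal.log (ENNReal.ofReal Λ))) :=
    (ENNReal.continuous_log.tendsto _).comp (ENNReal.tendsto_ofReal
      (tendsto_affine_mul_pow_rpow (by positivity) (by exact_mod_cast ha0) zero_le_two hΛ0))
  rw [← hΛ]
  exact ge_of_tendsto hlim (eventually_atTop.2 ⟨1, hbound⟩)

lemma uniformDimEntropy_le_log_of_surjective (𝒜 : FiniteAtlas d M) {f : M → M}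
    (hf : ContMDiff (𝓡 d) (𝓡 d) 1 f) (hsurj : Function.Surjective f) {k : ℕ} (hk : k ≤ d) :
    uniformDimEntropy 𝒜 k f ≤ ENNReal.log (normLambda d k f) := by
  rcases isEmpty_or_nonempty M with hM | hM
  -- On the empty manifold `normLambda` is `0`, with logarithm `⊥`, so the left side has to be `⊥`
  -- as well.
  · have : uniformDisks 𝒜 ⊤ k = ∅ :=
      Set.eq_empty_of_forall_notMem fun D ⟨φ, _⟩ ↦ hM.false (φ 0)
    rw [uniformDimEntropy, uniformDimEntropyOf, this, uniformEntropy_empty]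
    exact bot_le
  · have := uniformDimEntropy_le_log_max 𝒜 hf k
    rwa [max_eq_right (one_le_normLambda_of_surjective hf hsurj hk)] at this

end Main

end DimEntropy

end

theorem mainTheorem8 {d : ℕ} {M : Type*} [EMetricSpace M] [CompactSpace M]
    [ChartedSpace (EuclideanSpace ℝ (Fin d)) M] [IsManifold (𝓡 d) ∞ M]
    [RiemannianBundle (fun x : M ↦ TangentSpace (𝓡 d) x)]
    [IsContMDiffRiemannianBundle (𝓡 d) ∞ (EuclideanSpace ℝ (Fin d))
      (fun x : M ↦ TangentSpace (𝓡 d) x)]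
    [IsRiemannianManifold (𝓡 d) M]
    (𝒜 : DimEntropy.FiniteAtlas d M) :
    -- diffeomorphisms
    (∀ f : M ≃ₘ^1⟮𝓡 d, 𝓡 d⟯ M,
      (∀ k ≤ d, DimEntropy.uniformDimEntropy 𝒜 k f ≤
        ENNReal.log (DimEntropy.normLambda d k f)) ∧
      (0 < d → ENNReal.log (DimEntropy.normLambda d (d - 1) f) < DimEntropy.topEntropy f →
        DimEntropy.IsEntropyExpanding 𝒜 f) ∧
      (0 < d → ((d - 1 : ℕ) : EReal) * DimEntropy.lip f < DimEntropy.topEntropy f →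
        ENNReal.log (DimEntropy.normLambda d (d - 1) f) < DimEntropy.topEntropy f ∧
          DimEntropy.IsEntropyExpanding 𝒜 f)) ∧
    -- not necessarily invertible maps
    (∀ f : M → M, ContMDiff (𝓡 d) (𝓡 d) 1 f →
      (∀ k ≤ d, DimEntropy.uniformDimEntropy 𝒜 k f ≤
        ENNReal.log (max 1 (DimEntropy.normLambda d k f))) ∧
      (0 < d → ENNReal.log (max 1 (DimEntropy.normLambda d (d - 1) f)) < DimEntropy.topEntropy f →
        DimEntropy.IsEntropyExpanding 𝒜 f) ∧
      (0 < d → ((d - 1 : ℕ) : EReal) * DimEntropy.lip f < DimEntropy.topEntropy f →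
        ENNReal.log (max 1 (DimEntropy.normLambda d (d - 1) f)) < DimEntropy.topEntropy f ∧
          DimEntropy.IsEntropyExpanding 𝒜 f)) := by
  have : IsContinuousRiemannianBundle (EuclideanSpace ℝ (Fin d))
      (fun x : M ↦ TangentSpace (𝓡 d) x) := by
    obtain ⟨g, hg, hg'⟩ := IsContMDiffRiemannianBundle.exists_contMDiff (IB := 𝓡 d) (n := ∞)
      (F := EuclideanSpace ℝ (Fin d)) (E := fun x : M ↦ TangentSpace (𝓡 d) x)
    exact ⟨g, hg.continuous, hg'⟩
  refine ⟨fun f ↦ ?_, fun f hf ↦ ?_⟩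
  · have hA : ∀ k ≤ d, DimEntropy.uniformDimEntropy 𝒜 k f ≤
        ENNReal.log (DimEntropy.normLambda d k f) := fun k hk ↦
      DimEntropy.uniformDimEntropy_le_log_of_surjective 𝒜 f.contMDiff f.surjective hk
    have hB : ENNReal.log (DimEntropy.normLambda d (d - 1) f) < DimEntropy.topEntropy f →
        DimEntropy.IsEntropyExpanding 𝒜 f := fun h ↦ (hA (d - 1) (Nat.sub_le _ _)).trans_lt h
    refine ⟨hA, fun _ ↦ hB, fun _ h ↦ ?_⟩
    have hC := ((ENNReal.log_monotone (le_max_right 1 _)).trans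
      (DimEntropy.log_max_one_normLambda_le f.contMDiff (d - 1))).trans_lt h
    exact ⟨hC, hB hC⟩
  · have hA : ∀ k, DimEntropy.uniformDimEntropy 𝒜 k f ≤
        ENNReal.log (max 1 (DimEntropy.normLambda d k f)) :=
      DimEntropy.uniformDimEntropy_le_log_max 𝒜 hf
    have hB : ENNReal.log (max 1 (DimEntropy.normLambda d (d - 1) f)) < DimEntropy.topEntropy f →
        DimEntropy.IsEntropyExpanding 𝒜 f := fun h ↦ (hA (d - 1)).trans_lt h
    refine ⟨fun k _ ↦ hA k, fun _ ↦ hB, fun _ h ↦ ?_⟩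
    have hC := (DimEntropy.log_max_one_normLambda_le hf (d - 1)).trans_lt h
    exact ⟨hC, hB hC⟩
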